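/- **Ohno's relation for multiple polylogarithms.** *Notation.* An index is a finite sequence $\boldsymbol{k}=(k_1,\dots,k_r)$ of positive integers; it is admissible if it is empty or $k_r\ge 2$. Let $\mathbb{D}=\{z\in\mathbb{C}: |z|\le 1\}$. For an index $\boldsymbol{k}$ and $\boldsymbol{z}=(z_1,\dots,z_r)\in\mathbb{D}^r$ put $$\mathrm{Li}^{{\mathrm{sh}}}_{\boldsymbol{k}}(\boldsymbol{z})=\sum_{0=m_0<m_1<\cdots<m_r}\ \prod_{i=1}^r\frac{z_i^{m_i-m_{i-1}}}{m_i^{k_i}},\qquad O_h\binom{\boldsymbol{z}}{\boldsymbol{k}}=\sum_{\substack{c_1,\dots,c_r\ge0\\ c_1+\cdots+c_r=h}}\mathrm{Li}^{{\mathrm{sh}}}_{k_1+c_1,\dots,k_r+c_r}(\boldsymbol{z})\quad(h\ge0).$$ Let $\iota(\boldsymbol{z})$ be the number of $i$ with $z_i\ne1$. The pair $\binom{\boldsymbol{z}}{\boldsymbol{k}}$ satisfies the *dual condition* if every $z_i$ is a nonzero element of $\mathbb{D}$ with $\frac1{z_i}=1$ or $\left|1-\frac1{z_i}\right|\ge1$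 (that is, $z_i=1$ or $\mathrm{Re}(z_i)\le\frac12$), if $\mathrm{Re}(z_1)\neq\frac12$, and if $|z_r|\ne1$ in case $\boldsymbol{k}$ is not admissible. For a pair, let $\overset{v}{\longrightarrow}$ denote appending the column $\binom{v}{1}$, and let $\uparrow$ denote increasing the last entry of the index by $1$; every pair is built from the empty pair by writing each column $\binom{z}{k}$ as $\overset{z}{\longrightarrow}$ followed by $k-1$ arrows $\uparrow$. The *dual pair* $\binom{\boldsymbol{z}}{\boldsymbol{k}}^{\dagger}=\binom{\boldsymbol{z}'}{\boldsymbol{k}'}$ is obtained by reading the arrows that build $\binom{\boldsymbol{z}}{\boldsymbol{k}}$ from the last to the first and, starting from the empty pair, applying $\overset{1}{\longrightarrow}$ for each $\uparrow$, applying $\uparrow$ for each $\overset{1}{\longrightarrow}$, and applying $\overset{z/(z-1)}{\longrightarrow}$ for each $\overset{z}{\longrightarrow}$ with $z\neq1$. For a non-empty admissible index $\boldsymbol{k}=(\{1\}^{a_1-1},b_1+1,\dots,\{1\}^{a_s-1},b_s+1)$ with $a_i,b_i\ge1$, where $\{z\}^m$ means $m$ repetitions of $z$, the dual index is $\boldsymbol{k}^\dagger=(\{1\}^{b_s-1},a_s+1,\dots,\{1\}^{b_1-1},a_1+1)$.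 For a pair $\binom{\boldsymbol{z}}{\boldsymbol{k}}$ with $d=\iota(\boldsymbol{z})$ and for $b_1,\dots,b_d\ge0$, let $\binom{\boldsymbol{z}}{\boldsymbol{k}}_{b_1,\dots,b_d}$ be the pair obtained by replacing, for $j=1,\dots,d$, the $j$-th column $\binom{w}{l}$ with $w\ne1$ by $b_j$ columns $\binom{w}{1}$ followed by $\binom{w}{l}$. *Theorem.* Let $\boldsymbol{k}$ be a non-empty index and $\boldsymbol{z}\in\mathbb{D}^{r}$, where $r$ is the length of $\boldsymbol{k}$, such that $\binom{\boldsymbol{z}}{\boldsymbol{k}}$ satisfies the dual condition. Let $\binom{\boldsymbol{z}'}{\boldsymbol{k}'}$ be its dual and put $d=\iota(\boldsymbol{z})$. Then for every integer $h\ge0$ all the series below converge absolutely and $$O_h\binom{\boldsymbol{z}}{\boldsymbol{k}}=(-1)^d\sum_{i=0}^h\ \sum_{\substack{b_1,\dots,b_d\ge0\\ b_1+\cdots+b_d=i}}O_{h-i}\left(\binom{\boldsymbol{z}'}{\boldsymbol{k}'}_{b_1,\dots,b_d}\right).$$ In particular, if $d=0$, then $\boldsymbol{z}=(1,\dots,1)$,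 $\boldsymbol{k}$ is admissible, and $$O_h\binom{1,\dots,1}{\boldsymbol{k}}=O_h\binom{1,\dots,1}{\boldsymbol{k}^{\dagger}},$$ which is Ohno's relation for multiple zeta values. -/

import Mathlib

namespace MPL

/-- A pair `(z ; k)` consisting of an index `k = (k₁, …, k_r)` and a tuple `z = (z₁, …, z_r)` of
complex numbers of the same length, written as the list of its columns `(zᵢ, kᵢ)`. -/
abbrev IndexPair : Type := List (ℂ × ℕ)

/-- An index is a finite sequence of positive integers. -/
def IsIndex (k : List ℕ) : Prop := ∀ l ∈ k, 0 < l

/-- An index is admissible if it is empty or its last entry is at least `2`. -/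
def Admissible (k : List ℕ) : Prop := ∀ l ∈ k.getLast?, 2 ≤ l

/-- The pair `({1}^r ; k)`, where `r` is the depth of `k`. -/
def ones (k : List ℕ) : IndexPair := k.map fun l => (1, l)

/-- The tuples `0 = m₀ < m₁ < ⋯ < m_r` of integers. -/
abbrev Chain (r : ℕ) : Type := {m : Fin (r + 1) → ℕ // m 0 = 0 ∧ StrictMono m}

/-- The term `∏ᵢ zᵢ ^ (mᵢ - mᵢ₋₁) / mᵢ ^ kᵢ` of the shuffle-type multiple polylogarithm. -/
noncomputable def liTerm {r : ℕ} (z : Fin r → ℂ) (k : Fin r → ℕ) (m : Chain r) : ℂ :=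
  ∏ i : Fin r, z i ^ (m.1 i.succ - m.1 i.castSucc) / (m.1 i.succ : ℂ) ^ k i

/-- The shuffle-type multiple polylogarithm. -/
noncomputable def liSh {r : ℕ} (z : Fin r → ℂ) (k : Fin r → ℕ) : ℂ :=
  ∑' m : Chain r, liTerm z k m

/-- The sum `O_h(z ; k)` of `Li_{k₁ + c₁, …, k_r + c_r}(z)` over all `c₁ + ⋯ + c_r = h`. -/
noncomputable def ohnoSum (h : ℕ) (p : IndexPair) : ℂ :=
  ∑ c ∈ Finset.Nat.antidiagonalTuple p.length h,
    liSh (fun i => (p.get i).1) (fun i => (p.get i).2 + c i)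

/-- All the multiple polylogarithms occurring in `O_h(z ; k)` are absolutely convergent series. -/
def OhnoConverges (h : ℕ) (p : IndexPair) : Prop :=
  ∀ c ∈ Finset.Nat.antidiagonalTuple p.length h,
    Summable fun m : Chain p.length =>
      ‖liTerm (fun i => (p.get i).1) (fun i => (p.get i).2 + c i) m‖

/-- The finite part of `𝔹₁(1)`: the nonzero `v` in the closed unit disk with `1 / v = 1` or
`|1 - 1 / v| ≥ 1`. -/
def transportSet : Set ℂ := {v | v ≠ 0 ∧ ‖v‖ ≤ 1 ∧ (1 / v = 1 ∨ 1 ≤ ‖1 - 1 / v‖)}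

/-- The dual condition. -/
structure DualCondition (p : IndexPair) : Prop where
  mem : ∀ q ∈ p, q.1 ∈ transportSet
  head : ∀ q ∈ p.head?, q.1.re ≠ 1 / 2
  last : ¬ Admissible (p.map Prod.snd) → ∀ q ∈ p.getLast?, ‖q.1‖ ≠ 1

/-- `ι(z)`: the depth minus the number of `1`'s in `z`. -/
noncomputable def iota (p : IndexPair) : ℕ := p.length - (p.map Prod.fst).count 1

/-- `(z ; k)_→v`: append the column `(v, 1)`. -/
def arrow (p : IndexPair) (v : ℂ) : IndexPair := p ++ [(v, 1)]

/-- `(z ; k)_↑`: increase the last entry of `k` by one (the empty pair is unchanged). -/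
def up (p : IndexPair) : IndexPair := p.modifyLast fun q => (q.1, q.2 + 1)

/-- Transport of one column `(z, k)`, i.e. of `→z` followed by `k - 1` times `↑`, from the right
end of the first pair to the right end `q` of the second pair: each `↑` becomes `→1`, and then
`→z` becomes `↑` if `z = 1` and `→z/(z-1)` if `z ≠ 1`. -/
noncomputable def transportColumn (col : ℂ × ℕ) (q : IndexPair) : IndexPair :=
  let q' := (fun s => arrow s 1)^[col.2 - 1] q
  if col.1 = 1 then up q' else arrow q' (col.1 / (col.1 - 1))

/-- The dual `(z ; k)†`: transport all columns, the last one first, to the empty pair. -/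
noncomputable def dual (p : IndexPair) : IndexPair := p.foldr transportColumn []

/-- `(z ; k)_{b₁, …, b_d}`: the `j`-th column `(w, l)` with `w ≠ 1` is replaced by `b_j` columns
`(w, 1)` followed by `(w, l)`. (Missing `b`'s count as `0`.) -/
noncomputable def insertOnes : IndexPair → List ℕ → IndexPair
  | [], _ => []
  | (w, l) :: p, bs =>
      if w = 1 then (w, l) :: insertOnes p bs
      else List.replicate (bs.headD 0) (w, 1) ++ (w, l) :: insertOnes p bs.tail

/-- The blocks `(aᵢ, bᵢ)` in the expression `({1}^{a₁-1}, b₁+1, …, {1}^{a_h-1}, b_h+1)` of an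
admissible index; the first argument counts the `1`'s already read in the current block. -/
def blocks : ℕ → List ℕ → List (ℕ × ℕ)
  | _, [] => []
  | a, l :: k => if l = 1 then blocks (a + 1) k else (a + 1, l - 1) :: blocks 0 k

/-- The dual index `k† = ({1}^{b_h-1}, a_h+1, …, {1}^{b₁-1}, a₁+1)` of an admissible index `k`. -/
def dualIndex (k : List ℕ) : List ℕ :=
  (blocks 0 k).reverse.flatMap fun ab => List.replicate (ab.2 - 1) 1 ++ [ab.1 + 1]

end MPL

namespace MPL

open Filter Topology Finset
open scoped ENNReal

variable {x : ℝ}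

/-! ### The connector -/

/-! The proof is the method of connected sums, applied to generating functions in a small real
variable `x > 0`. Multiplying `O_h` by `x ^ h` and summing over `h` turns `1 / m ^ (k + c)` into `1
/ ((m - x) m ^ (k - 1))`, a geometric series. The generating function of the left side is thus a sum
over increasing chains, that is, a composition of operators on functions of `n`, one kernel `kerL`
per arrow. On the dual side, the inserted columns with weight `x ^ b` expand the product of the
factors `i / (i - x) = 1 + x / (i - x)`. This replaces `1 / (n - x)` by `ratio` for the arrows `→w`
with `w ≠ 1` and leads to the kernels `kerR`.

The two sides are joined by the connector `conn x n m`, which is symmetric and equals `1` when `n =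
0` or `m = 0`. An arrow acting on the connector in the variable `n` gives, up to sign, the same as
the dual arrow acting in `m` (`app_kerL_conn_eq_app_kerR_conn`). For `z ≠ 1` and `w = z / (z - 1)`
this expresses `z / (1 - z t) = -w / (1 - w (1 - t))` under a beta integral, expanded in powers of
`t` on one side and of `1 - t` on the other (`tsum_bet_transport`). For `→1` and `↑` it is a
telescoping sum. Carrying all arrows across, the last one first, starting from `n = m = 0`, gives
the identity of generating functions (`foldr_app_kerL_conn`). The arrows arrive as the word of the
dual pair (`word_dual`), and each `→z` with `z ≠ 1` costs a sign, whence `(-1) ^ d`.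

Every rearrangement is justified by computing with absolute values in `ℝ≥0∞`. The kernels `kerR`
applied to the connector cost at most a factor `(1 - x)⁻¹` (`appE_kerR_connE_le`). The last arrow
must be `↑` or satisfy `‖z‖ < 1 - x`, which the dual condition ensures at both ends for small `x`.
Finally, coefficients are compared by `eq_zero_of_hasSum_pow_mul_zero`. -/

/-- The shifted factorial `∏_{i = 1}^n (i - x)`. -/
noncomputable def poch (x : ℝ) (n : ℕ) : ℝ := ∏ i ∈ range n, ((i : ℝ) + 1 - x)

/-- The beta integral `∫₀¹ t ^ (n - x) (1 - t) ^ m dt`. -/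
noncomputable def bet (x : ℝ) (n m : ℕ) : ℝ := m.factorial * poch x n / poch x (n + m + 1)

/-- The connector of the connected sums. -/
noncomputable def conn (x : ℝ) (n m : ℕ) : ℝ := poch x n * poch x m / poch x (n + m)

lemma poch_zero : poch x 0 = 1 := by simp [poch]

lemma poch_succ (n : ℕ) : poch x (n + 1) = poch x n * ((n : ℝ) + 1 - x) := by
  simp [poch, prod_range_succ]

lemma poch_pos (hx : x < 1) (n : ℕ) : 0 < poch x n :=
  prod_pos fun i _ => by
    have : (0 : ℝ) ≤ i := i.cast_nonneg
    linarith

lemma natCast_sub_pos (hx : x < 1) {n : ℕ} (hn : 1 ≤ n) : 0 < (n : ℝ) - x := by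
  have : (1 : ℝ) ≤ n := by exact_mod_cast hn
  linarith

lemma bet_pos (hx : x < 1) (n m : ℕ) : 0 < bet x n m := by
  have := poch_pos hx n
  have := poch_pos hx (n + m + 1)
  have : (0 : ℝ) < m.factorial := by exact_mod_cast m.factorial_pos
  unfold bet
  positivity

lemma conn_pos (hx : x < 1) (n m : ℕ) : 0 < conn x n m := by
  have := poch_pos hx n
  have := poch_pos hx m
  have := poch_pos hx (n + m)
  unfold conn
  positivity

lemma conn_comm (n m : ℕ) : conn x n m = conn x m n := by
  simp only [conn, mul_comm, add_comm]

lemma conn_zero_left (hx : x < 1) (m : ℕ) : conn x 0 m = 1 := by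
  simp [conn, poch_zero, (poch_pos hx m).ne']

lemma conn_zero_right (hx : x < 1) (n : ℕ) : conn x n 0 = 1 := by
  rw [conn_comm, conn_zero_left hx]

lemma conn_one_left (hx : x < 1) (m : ℕ) : conn x 1 m = (1 - x) / ((m : ℝ) + 1 - x) := by
  have h1 := (poch_pos hx m).ne'
  have h2 : (m : ℝ) + 1 - x ≠ 0 := by
    have := natCast_sub_pos hx (Nat.succ_pos m)
    push_cast at this
    exact this.ne'
  have h3 : poch x 1 = 1 - x := by simp [poch]
  rw [conn, add_comm 1 m, poch_succ m, h3]
  field_simp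

/-- Under the beta integral this is `1 - t` absorbed into the power of `1 - t`. All telescoping sums
below come from it. -/
lemma bet_sub (hx : x < 1) (n m : ℕ) : bet x n m - bet x (n + 1) m = bet x n (m + 1) := by
  have h1 := (poch_pos hx (n + m + 1)).ne'
  have h2 := natCast_sub_pos hx (show 1 ≤ n + m + 2 by omega)
  have h3 : bet x (n + 1) m
      = m.factorial * (poch x n * ((n : ℝ) + 1 - x)) / (poch x (n + m + 1) * ((n + m + 2 : ℕ) - x)) := by
    rw [bet, show n + 1 + m + 1 = (n + m + 1) + 1 by ring, poch_succ, poch_succ]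
    push_cast
    ring_nf
  have h4 : bet x n (m + 1)
      = (m + 1) * m.factorial * poch x n / (poch x (n + m + 1) * ((n + m + 2 : ℕ) - x)) := by
    rw [bet, show n + (m + 1) + 1 = (n + m + 1) + 1 by ring, poch_succ, Nat.factorial_succ]
    push_cast
    ring_nf
  rw [h3, h4, bet, div_sub_div _ _ h1 (mul_ne_zero h1 h2.ne'), div_eq_div_iff]
  · push_cast
    ring
  · exact mul_ne_zero h1 (mul_ne_zero h1 h2.ne')
  · exact mul_ne_zero h1 h2.ne'

lemma bet_zero_right (hx : x < 1) (n : ℕ) : bet x n 0 = 1 / ((n : ℝ) + 1 - x) := by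
  have h1 := (poch_pos hx n).ne'
  have h2 := natCast_sub_pos hx (Nat.succ_pos n)
  push_cast at h2
  simp only [bet, add_zero, poch_succ]
  field_simp
  simp

lemma bet_antitone_left (hx : x < 1) (m : ℕ) : Antitone fun n => bet x n m :=
  antitone_nat_of_succ_le fun n => by
    have := bet_sub hx n m
    have := bet_pos hx n (m + 1)
    linarith

lemma bet_antitone_right (hx : x < 1) (n : ℕ) : Antitone fun m => bet x n m :=
  antitone_nat_of_succ_le fun m => by
    have := bet_sub hx n m
    have := bet_pos hx (n + 1) m
    linarith

lemma tendsto_bet (hx : x < 1) (n m : ℕ) : Tendsto (fun k => bet x (n + k) m) atTop (𝓝 0) := by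
  have h : Tendsto (fun k : ℕ => 1 / ((k : ℝ) + (n + 1 - x))) atTop (𝓝 0) := by
    simp only [one_div]
    exact (tendsto_natCast_atTop_atTop.atTop_add tendsto_const_nhds).inv_tendsto_atTop
  refine squeeze_zero (fun k => (bet_pos hx _ _).le) (fun k => ?_) h
  refine (bet_antitone_right hx (n + k) (Nat.zero_le m)).trans (le_of_eq ?_)
  simp only [bet_zero_right hx]
  push_cast
  ring_nf

lemma hasSum_bet_left (hx : x < 1) (n m : ℕ) :
    HasSum (fun k => bet x (n + k) (m + 1)) (bet x n m) := by
  rw [hasSum_iff_tendsto_nat_of_nonneg fun k => (bet_pos hx _ _).le]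
  have h : ∀ N, ∑ k ∈ range N, bet x (n + k) (m + 1) = bet x n m - bet x (n + N) m := fun N => by
    have := Finset.sum_range_sub' (fun k => bet x (n + k) m) N
    rw [add_zero] at this
    rw [← this]
    exact sum_congr rfl fun k _ => (bet_sub hx (n + k) m).symm
  simp only [h]
  simpa using (tendsto_bet hx n m).const_sub (bet x n m)

/-- Telescoping of `bet_sub` in the second variable. Only an upper bound is needed, so the boundary
term is dropped by positivity instead of being sent to its limit. -/
lemma sum_range_bet_right_le (hx : x < 1) (n m N : ℕ) :
    ∑ k ∈ range N, bet x (n + 1) (m + k) ≤ bet x n m := by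
  have h : ∑ k ∈ range N, bet x (n + 1) (m + k) = bet x n m - bet x n (m + N) := by
    have := Finset.sum_range_sub' (fun k => bet x n (m + k)) N
    rw [add_zero] at this
    rw [← this]
    refine sum_congr rfl fun k _ => ?_
    have := bet_sub hx n (m + k)
    rw [← add_assoc]
    linarith
  rw [h]
  linarith [bet_pos hx n (m + N)]

lemma summable_bet_right (hx : x < 1) (n m : ℕ) : Summable fun k => bet x (n + 1) (m + k) :=
  summable_of_sum_range_le (fun _ => (bet_pos hx _ _).le) (sum_range_bet_right_le hx n m)

lemma tsum_bet_right_le (hx : x < 1) (n m : ℕ) : ∑' k, bet x (n + 1) (m + k) ≤ bet x n m :=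
  Real.tsum_le_of_sum_range_le (fun _ => (bet_pos hx _ _).le) (sum_range_bet_right_le hx n m)

/-- For `1 ≤ m` the telescoping series converges by itself; for `m = 0` the beta values are only of
order `1 / (n + k)`, and the geometric factor must help. -/
lemma summable_pow_mul_bet_left (hx : x < 1) {ρ : ℝ} (h0 : 0 ≤ ρ) (h1 : ρ ≤ 1) (n m : ℕ)
    (h : 1 ≤ m ∨ ρ < 1) : Summable fun k => ρ ^ k * bet x (n + k) m := by
  rcases h with h | h
  · obtain ⟨m, rfl⟩ := Nat.exists_eq_add_of_le' h
    refine (hasSum_bet_left hx n m).summable.of_nonneg_of_le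
      (fun k => mul_nonneg (pow_nonneg h0 k) (bet_pos hx _ _).le) fun k => ?_
    exact mul_le_of_le_one_left (bet_pos hx _ _).le (pow_le_one₀ h0 h1)
  · refine ((summable_geometric_of_lt_one h0 h).mul_right (bet x n m)).of_nonneg_of_le
      (fun k => mul_nonneg (pow_nonneg h0 k) (bet_pos hx _ _).le) fun k => ?_
    exact mul_le_mul_of_nonneg_left (bet_antitone_left hx m (Nat.le_add_right n k))
      (pow_nonneg h0 k)

lemma summable_pow_mul_bet_right (hx : x < 1) {ρ : ℝ} (h0 : 0 ≤ ρ) (h1 : ρ ≤ 1) (n m : ℕ)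
    (h : 1 ≤ n ∨ ρ < 1) : Summable fun k => ρ ^ k * bet x n (m + k) := by
  rcases h with h | h
  · obtain ⟨n, rfl⟩ := Nat.exists_eq_add_of_le' h
    refine (summable_bet_right hx n m).of_nonneg_of_le
      (fun k => mul_nonneg (pow_nonneg h0 k) (bet_pos hx _ _).le) fun k => ?_
    exact mul_le_of_le_one_left (bet_pos hx _ _).le (pow_le_one₀ h0 h1)
  · refine ((summable_geometric_of_lt_one h0 h).mul_right (bet x n m)).of_nonneg_of_le
      (fun k => mul_nonneg (pow_nonneg h0 k) (bet_pos hx _ _).le) fun k => ?_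
    exact mul_le_mul_of_nonneg_left (bet_antitone_right hx n (Nat.le_add_right m k))
      (pow_nonneg h0 k)

/-- Both sides are the integral of `z t ^ (n - x) (1 - t) ^ m / (1 - z t)` over `[0, 1]`. -/
lemma tsum_bet_transport (hx : x < 1) {z w : ℂ} (hz : ‖z‖ ≤ 1) (hw : ‖w‖ ≤ 1)
    (hzw : z * w = z + w) (n m : ℕ) (hm : 1 ≤ m ∨ ‖z‖ < 1) (hn : 1 ≤ n ∨ ‖w‖ < 1) :
    z * ∑' k, z ^ k * (bet x (n + k) m : ℂ) = -(w * ∑' k, w ^ k * (bet x n (m + k) : ℂ)) := by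
  have nb : ∀ i j, ‖(bet x i j : ℂ)‖ = bet x i j := fun i j =>
    (Complex.norm_real _).trans (Real.norm_of_nonneg (bet_pos hx i j).le)
  have sL : ∀ i, Summable fun k => z ^ k * (bet x (i + k) m : ℂ) := fun i => by
    refine Summable.of_norm ?_
    simpa only [norm_mul, norm_pow, nb] using
      summable_pow_mul_bet_left hx (norm_nonneg z) hz i m hm
  have sRn : ∀ i, 1 ≤ i ∨ ‖w‖ < 1 → Summable fun k => ‖w‖ ^ k * bet x i (m + k) := fun i hi =>
    summable_pow_mul_bet_right hx (norm_nonneg w) hw i m hi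
  have sR : ∀ i, 1 ≤ i ∨ ‖w‖ < 1 → Summable fun k => w ^ k * (bet x i (m + k) : ℂ) :=
    fun i hi => Summable.of_norm (by simpa only [norm_mul, norm_pow, nb] using sRn i hi)
  have hi : ∀ i, 1 ≤ n + i ∨ ‖w‖ < 1 := fun i => hn.imp (fun h => by omega) id
  -- `L i` and `R i` are the two sides with `n` replaced by `n + i`. Both satisfy `X i = z * bet x
  -- (n + i) m + z * X (i + 1)`, so the difference at `0` is `z ^ i` times that at `i`. Since `‖z‖ =
  -- 1` is allowed, its vanishing in the limit needs separate arguments for `L` and `R`.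
  set L : ℕ → ℂ := fun i => z * ∑' k, z ^ k * (bet x (n + i + k) m : ℂ) with hL
  set R : ℕ → ℂ := fun i => -(w * ∑' k, w ^ k * (bet x (n + i) (m + k) : ℂ)) with hR
  have recL : ∀ i, L i = z * bet x (n + i) m + z * L (i + 1) := fun i => by
    simp only [hL]
    rw [(sL (n + i)).tsum_eq_zero_add, mul_add]
    congr 1
    · simp
    · rw [← tsum_mul_left, ← tsum_mul_left, ← tsum_mul_left]
      refine tsum_congr fun k => ?_
      rw [show n + i + (k + 1) = n + (i + 1) + k by ring]
      ring
  -- Here `bet_sub` lowers `n + i + 1` to `n + i`, and the first term of the series is split off;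
  -- what remains is `z * w = z + w`.
  have recR : ∀ i, R i = z * bet x (n + i) m + z * R (i + 1) := fun i => by
    have e : ∑' k, w ^ k * (bet x (n + (i + 1)) (m + k) : ℂ)
        = ∑' k, w ^ k * (bet x (n + i) (m + k) : ℂ)
          - ∑' k, w ^ k * (bet x (n + i) (m + (k + 1)) : ℂ) := by
      have s' : Summable fun k => w ^ k * (bet x (n + i) (m + (k + 1)) : ℂ) := by
        have := (sR (n + i) (hi i)).sub (sR (n + (i + 1)) (hi (i + 1)))
        refine this.congr fun k => ?_
        rw [← mul_sub, ← add_assoc, ← add_assoc, ← bet_sub hx (n + i) (m + k)]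
        push_cast
        ring
      rw [← (sR (n + i) (hi i)).tsum_sub s']
      congr 1
      ext k
      rw [← mul_sub, ← add_assoc, ← add_assoc, ← bet_sub hx (n + i) (m + k)]
      push_cast
      ring
    have e2 : ∑' k, w ^ k * (bet x (n + i) (m + k) : ℂ) = bet x (n + i) m
        + w * ∑' k, w ^ k * (bet x (n + i) (m + (k + 1)) : ℂ) := by
      rw [(sR (n + i) (hi i)).tsum_eq_zero_add, ← tsum_mul_left]
      congr 1
      · simp
      · congr 1
        ext k
        ring
    simp only [hR]
    rw [e, e2]
    set T := ∑' k, w ^ k * (bet x (n + i) (m + (k + 1)) : ℂ)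
    linear_combination (bet x (n + i) m + w * T) * hzw
  have hD : ∀ i, L 0 - R 0 = z ^ i * (L i - R i) := fun i => by
    induction i with
    | zero => simp
    | succ i ih =>
      rw [ih, recL i, recR i]
      ring
  -- Up to the factor `z`, this is the tail of a convergent series.
  have tL : Tendsto (fun i => z ^ i * L i) atTop (𝓝 0) := by
    have := (tendsto_sum_nat_add fun k => z ^ k * (bet x (n + k) m : ℂ)).const_mul z
    rw [mul_zero] at this
    refine this.congr fun i => ?_
    simp only [hL]
    rw [mul_left_comm (z ^ i), ← tsum_mul_left (a := z ^ i)]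
    congr 1
    refine tsum_congr fun k => ?_
    rw [show n + (k + i) = n + i + k by ring]
    ring
  have tR0 : Tendsto R atTop (𝓝 0) := by
    have := tendsto_tsum_of_dominated_convergence (𝓕 := atTop)
      (f := fun i k => w ^ k * (bet x (n + i) (m + k) : ℂ)) (g := fun _ => 0) (sRn n hn)
      (fun k => by
        have := ((Complex.continuous_ofReal.tendsto _).comp
          (tendsto_bet hx n (m + k))).const_mul (w ^ k)
        simpa using this)
      (Eventually.of_forall fun i k => by
        rw [norm_mul, norm_pow, nb]
        exact mul_le_mul_of_nonneg_left (bet_antitone_left hx _ (Nat.le_add_right n i))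
          (by positivity))
    have := (this.const_mul w).neg
    simpa using this
  have tR : Tendsto (fun i => z ^ i * R i) atTop (𝓝 0) := by
    refine squeeze_zero_norm (fun i => ?_) (tendsto_zero_iff_norm_tendsto_zero.1 tR0)
    rw [norm_mul, norm_pow]
    exact mul_le_of_le_one_left (norm_nonneg _) (pow_le_one₀ (norm_nonneg _) hz)
  have h0 : L 0 - R 0 = 0 := by
    refine tendsto_nhds_unique (f := fun _ : ℕ => L 0 - R 0) tendsto_const_nhds ?_ (l := atTop)
    have := tL.sub tR
    rw [sub_zero] at this
    refine this.congr fun i => ?_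
    rw [hD i, mul_sub]
  simpa [hL, hR] using sub_eq_zero.1 h0

/-! ### Kernels and the transport of one arrow -/

/-- The arrows `↑` and `→z`. -/
inductive Letter where
  | up : Letter
  | arr (z : ℂ) : Letter

/-- The operator with kernel `K`. -/
noncomputable def app {α : Type*} (K : α → α → ℂ) (f : α → ℂ) (a : α) : ℂ := ∑' b, K a b * f b

/-- The operator with kernel `|K|` on nonnegative functions. -/
noncomputable def appE {α : Type*} (K : α → α → ℂ) (f : α → ℝ≥0∞) (a : α) : ℝ≥0∞ :=
  ∑' b, ‖K a b‖ₑ * f b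

/-- The factor `1 / (n - x) ∏_{m < i < n} i / (i - x)`. -/
noncomputable def ratio (x : ℝ) (m n : ℕ) : ℝ :=
  poch x m / m.factorial * ((n - 1).factorial / poch x n)

/-- The kernel of an arrow in the generating function of the sums `O_h`. -/
noncomputable def kerL (x : ℝ) : Letter → ℕ → ℕ → ℂ
  | .up, m, n => if n = m then (m : ℂ)⁻¹ else 0
  | .arr z, m, n => if m < n then z ^ (n - m) * ((((n : ℝ) - x)⁻¹ : ℝ) : ℂ) else 0

open Classical in
/-- The factor of the kernel of `→z` that depends on `x`, with insertions if `z ≠ 1`. -/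
noncomputable def weightR (x : ℝ) (z : ℂ) (m n : ℕ) : ℝ :=
  if z = 1 then ((n : ℝ) - x)⁻¹ else ratio x m n

/-- The kernel of an arrow in the generating function of the sums `O_h` with insertions. -/
noncomputable def kerR (x : ℝ) : Letter → ℕ → ℕ → ℂ
  | .up, m, n => if n = m then (m : ℂ)⁻¹ else 0
  | .arr z, m, n => if m < n then z ^ (n - m) * (weightR x z m n : ℂ) else 0

open Classical in
/-- The arrow dual to a given one. -/
noncomputable def Letter.dual : Letter → Letter
  | .up => .arr 1
  | .arr z => if z = 1 then .up else .arr (z / (z - 1))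

open Classical in
/-- The sign in the transport of an arrow. -/
noncomputable def Letter.sign : Letter → ℂ
  | .up => 1
  | .arr z => if z = 1 then 1 else -1

/-- An arrow that may come last. -/
def Letter.LastOK (x : ℝ) : Letter → Prop
  | .up => True
  | .arr z => ‖z‖ < 1 - x

/-- The arrows to which transport applies. -/
def Letter.Valid : Letter → Prop
  | .up => True
  | .arr z => z = 1 ∨ ‖z‖ ≤ 1 ∧ ‖z / (z - 1)‖ ≤ 1

/-- The arrows `→z` with `|z| ≤ 1`, and `↑`. -/
def Letter.NormLe : Letter → Prop
  | .up => True
  | .arr z => ‖z‖ ≤ 1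

/-- Being one of the arrows `→z`. -/
def Letter.IsArr : Letter → Prop
  | .up => False
  | .arr _ => True

lemma tsum_ite_lt {M : Type*} [AddCommMonoid M] [TopologicalSpace M] [T2Space M] (n : ℕ)
    (f : ℕ → M) : ∑' m, (if n < m then f m else 0) = ∑' k, f (n + 1 + k) := by
  have hinj : Function.Injective fun k => n + 1 + k := fun a b h => by simpa using h
  rw [← hinj.tsum_eq]
  · exact tsum_congr fun k => if_pos (by omega)
  · intro m hm
    by_cases h : n < m
    · exact ⟨m - (n + 1), by dsimp only; omega⟩
    · simp [h] at hm

lemma app_kerL_arr (z : ℂ) (f : ℕ → ℂ) (n : ℕ) :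
    app (kerL x (.arr z)) f n
      = ∑' k, z ^ (k + 1) * ((((n + 1 + k : ℕ) - x)⁻¹ : ℝ) : ℂ) * f (n + 1 + k) := by
  simp only [app, kerL, ite_mul, zero_mul]
  rw [tsum_ite_lt n fun m => z ^ (m - n) * ((((m : ℝ) - x)⁻¹ : ℝ) : ℂ) * f m]
  refine tsum_congr fun k => ?_
  rw [show n + 1 + k - n = k + 1 by omega]

lemma app_kerR_arr (z : ℂ) (f : ℕ → ℂ) (n : ℕ) :
    app (kerR x (.arr z)) f n
      = ∑' k, z ^ (k + 1) * (weightR x z n (n + 1 + k) : ℂ) * f (n + 1 + k) := by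
  simp only [app, kerR, ite_mul, zero_mul]
  rw [tsum_ite_lt n fun m => z ^ (m - n) * (weightR x z n m : ℂ) * f m]
  refine tsum_congr fun k => ?_
  rw [show n + 1 + k - n = k + 1 by omega]

lemma appE_kerR_arr (z : ℂ) (f : ℕ → ℝ≥0∞) (n : ℕ) :
    appE (kerR x (.arr z)) f n
      = ∑' k, ‖z ^ (k + 1) * (weightR x z n (n + 1 + k) : ℂ)‖ₑ * f (n + 1 + k) := by
  have h : ∀ m, ‖kerR x (.arr z) n m‖ₑ * f m
      = if n < m then ‖z ^ (m - n) * (weightR x z n m : ℂ)‖ₑ * f m else 0 := fun m => by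
    by_cases h : n < m <;> simp [kerR, h]
  simp only [appE, h]
  rw [tsum_ite_lt n fun m => ‖z ^ (m - n) * (weightR x z n m : ℂ)‖ₑ * f m]
  refine tsum_congr fun k => ?_
  rw [show n + 1 + k - n = k + 1 by omega]

lemma app_kerL_up (f : ℕ → ℂ) (n : ℕ) : app (kerL x .up) f n = (n : ℂ)⁻¹ * f n := by
  simp only [app, kerL, ite_mul, zero_mul]
  rw [tsum_ite_eq]

lemma app_kerR_up (f : ℕ → ℂ) (n : ℕ) : app (kerR x .up) f n = (n : ℂ)⁻¹ * f n :=
  app_kerL_up (x := x) f n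

lemma appE_kerL_up (f : ℕ → ℝ≥0∞) (n : ℕ) : appE (kerL x .up) f n = ‖(n : ℂ)⁻¹‖ₑ * f n := by
  have h : ∀ m, ‖kerL x .up n m‖ₑ * f m = if m = n then ‖(n : ℂ)⁻¹‖ₑ * f n else 0 := fun m => by
    by_cases h : m = n <;> simp [kerL, h]
  simp only [appE, h]
  rw [tsum_ite_eq n fun _ => ‖(n : ℂ)⁻¹‖ₑ * f n]

lemma appE_kerR_up (f : ℕ → ℝ≥0∞) (n : ℕ) : appE (kerR x .up) f n = ‖(n : ℂ)⁻¹‖ₑ * f n :=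
  appE_kerL_up (x := x) f n

/-- Weight times connector is a beta value up to a factor that does not involve the summation
variable `n`. With `ratio_mul_conn`, which has the same factor, this reduces transport to an
identity between beta series. -/
lemma inv_mul_conn_succ (hx : x < 1) (n m : ℕ) :
    ((n + 1 : ℕ) - x)⁻¹ * conn x (n + 1) m = poch x m / m.factorial * bet x n m := by
  have h1 := (poch_pos hx (n + m + 1)).ne'
  have h2 := (natCast_sub_pos hx (Nat.succ_pos n)).ne'
  have h3 : (m.factorial : ℝ) ≠ 0 := by exact_mod_cast m.factorial_pos.ne'
  rw [conn, bet, poch_succ, show n + 1 + m = n + m + 1 by ring]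
  push_cast at h2 ⊢
  field_simp

/-- The weight `ratio` is what makes this come out with the factor `poch x m / m.factorial` of
`inv_mul_conn_succ`; the insertions on the dual side account for it. -/
lemma ratio_mul_conn (hx : x < 1) (n m k : ℕ) :
    ratio x m (m + 1 + k) * conn x n (m + 1 + k)
      = poch x m / m.factorial * bet x n (m + k) := by
  have h1 := (poch_pos hx (n + (m + k) + 1)).ne'
  have h2 := (poch_pos hx (m + k + 1)).ne'
  have h3 : (m.factorial : ℝ) ≠ 0 := by exact_mod_cast m.factorial_pos.ne'
  rw [conn, bet, ratio, show m + 1 + k = m + k + 1 by ring,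
    show n + (m + k + 1) = n + (m + k) + 1 by ring, Nat.add_sub_cancel]
  field_simp

/-- After `inv_mul_conn_succ` the terms are beta values that telescope; this is the transport of
`→1` into `↑`. -/
lemma hasSum_inv_mul_conn (hx : x < 1) (n m : ℕ) (hm : 1 ≤ m) :
    HasSum (fun k : ℕ => ((n + 1 + k : ℕ) - x)⁻¹ * conn x (n + 1 + k) m) (conn x n m / m) := by
  obtain ⟨m, rfl⟩ := Nat.exists_eq_add_of_le' hm
  have h1 := (poch_pos hx (n + m + 1)).ne'
  have h3 : (m.factorial : ℝ) ≠ 0 := by exact_mod_cast m.factorial_pos.ne'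
  have h := (hasSum_bet_left hx n m).mul_left (poch x (m + 1) / (m + 1).factorial)
  have e : poch x (m + 1) / (m + 1).factorial * bet x n m = conn x n (m + 1) / (m + 1 : ℕ) := by
    rw [conn, bet, Nat.factorial_succ, show n + (m + 1) = n + m + 1 by ring]
    push_cast
    field_simp
  rw [e] at h
  refine h.congr_fun fun k => ?_
  rw [show n + 1 + k = n + k + 1 by ring, inv_mul_conn_succ hx]

lemma app_kerL_arr_conn (hx : x < 1) (z : ℂ) (n m : ℕ) :
    app (kerL x (.arr z)) (fun n => (conn x n m : ℂ)) n
      = ((poch x m / m.factorial : ℝ) : ℂ) * (z * ∑' k, z ^ k * (bet x (n + k) m : ℂ)) := by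
  rw [app_kerL_arr, ← tsum_mul_left, ← tsum_mul_left]
  refine tsum_congr fun k => ?_
  rw [mul_assoc, ← Complex.ofReal_mul, show n + 1 + k = n + k + 1 by ring, inv_mul_conn_succ hx]
  push_cast
  ring

lemma app_kerR_arr_conn (hx : x < 1) {z : ℂ} (hz : z ≠ 1) (n m : ℕ) :
    app (kerR x (.arr z)) (fun m => (conn x n m : ℂ)) m
      = ((poch x m / m.factorial : ℝ) : ℂ) * (z * ∑' k, z ^ k * (bet x n (m + k) : ℂ)) := by
  rw [app_kerR_arr, ← tsum_mul_left, ← tsum_mul_left]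
  refine tsum_congr fun k => ?_
  rw [weightR, if_neg hz, mul_assoc, ← Complex.ofReal_mul, ratio_mul_conn hx]
  push_cast
  ring

lemma app_kerL_one_conn (hx : x < 1) (n m : ℕ) (hm : 1 ≤ m) :
    app (kerL x (.arr 1)) (fun n => (conn x n m : ℂ)) n = (m : ℂ)⁻¹ * conn x n m := by
  rw [app_kerL_arr]
  have h := congrArg (fun r : ℝ => (r : ℂ)) (hasSum_inv_mul_conn hx n m hm).tsum_eq
  simp only [Complex.ofReal_tsum] at h
  rw [← tsum_congr fun k => ?_, h]
  · push_cast
    ring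
  · push_cast
    ring

lemma app_kerR_one_conn (hx : x < 1) (n m : ℕ) (hn : 1 ≤ n) :
    app (kerR x (.arr 1)) (fun m => (conn x n m : ℂ)) m = (n : ℂ)⁻¹ * conn x n m := by
  have h := app_kerL_one_conn hx m n hn
  rw [app_kerL_arr] at h
  rw [app_kerR_arr, conn_comm n m, ← h]
  refine tsum_congr fun k => ?_
  rw [weightR, if_pos rfl, conn_comm]

/-- The transport relations. -/
lemma app_kerL_conn_eq_app_kerR_conn (h0 : 0 < x) (hx : x < 1) (ℓ : Letter) (hℓ : ℓ.Valid)
    (n m : ℕ) (hn : 1 ≤ n ∨ ℓ.dual.LastOK x) (hm : 1 ≤ m ∨ ℓ.LastOK x) :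
    app (kerL x ℓ) (fun n => (conn x n m : ℂ)) n
      = ℓ.sign * app (kerR x ℓ.dual) (fun m => (conn x n m : ℂ)) m := by
  cases ℓ with
  | up =>
    -- The dual arrow is `→1`, and `‖1‖ < 1 - x` fails for `x > 0`.
    have hn : 1 ≤ n := hn.resolve_right fun h => by
      simp [Letter.dual, Letter.LastOK] at h
      linarith
    simp only [Letter.dual, Letter.sign]
    rw [app_kerL_up, app_kerR_one_conn hx n m hn, one_mul]
  | arr z =>
    by_cases hz : z = 1
    · subst hz
      have hm : 1 ≤ m := hm.resolve_right fun h => by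
        simp [Letter.LastOK] at h
        linarith
      simp only [Letter.dual, Letter.sign, if_true]
      rw [app_kerR_up, app_kerL_one_conn hx n m hm, one_mul]
    · have hz1 : z - 1 ≠ 0 := sub_ne_zero.2 hz
      have hw : z / (z - 1) ≠ 1 := fun h => by
        rw [div_eq_one_iff_eq hz1] at h
        have : (1 : ℂ) = 0 := by linear_combination h
        exact one_ne_zero this
      obtain ⟨hz2, hw2⟩ := hℓ.resolve_left hz
      simp only [Letter.dual, Letter.sign, if_neg hz, Letter.LastOK] at hn hm ⊢
      rw [app_kerL_arr_conn hx, app_kerR_arr_conn hx hw,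
        tsum_bet_transport hx hz2 hw2 (by field_simp; ring) n m
          (hm.imp id fun h => by linarith) (hn.imp id fun h => by linarith)]
      ring

/-! ### General facts on kernels -/

section Kernel

variable {α : Type*} {β : Type*}

/-- The comparison of functions is required only on the support of the kernel, so that bounds known
for positive indices can be used after any step. -/
lemma appE_mono {K L : α → α → ℂ} {f g : α → ℝ≥0∞} {a : α} (hK : ∀ b, ‖K a b‖ₑ ≤ ‖L a b‖ₑ)
    (hf : ∀ b, K a b ≠ 0 → f b ≤ g b) : appE K f a ≤ appE L g a := by
  refine ENNReal.tsum_le_tsum fun b => ?_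
  by_cases h : K a b = 0
  · simp [h]
  · exact mul_le_mul' (hK b) (hf b h)

lemma appE_const_mul (K : α → α → ℂ) (c : ℝ≥0∞) (f : α → ℝ≥0∞) (a : α) :
    appE K (fun b => c * f b) a = c * appE K f a := by
  simp only [appE, mul_left_comm _ c, ENNReal.tsum_mul_left]

lemma app_const_mul (K : α → α → ℂ) (c : ℂ) (f : α → ℂ) (a : α) :
    app K (fun b => c * f b) a = c * app K f a := by
  simp only [app, mul_left_comm _ c, tsum_mul_left]

lemma foldr_app_const_mul (Ks : List (α → α → ℂ)) (c : ℂ) (f : α → ℂ) (a : α) :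
    Ks.foldr app (fun b => c * f b) a = c * Ks.foldr app f a := by
  induction Ks generalizing a with
  | nil => rfl
  | cons K Ks ih =>
    simp only [List.foldr_cons]
    rw [← app_const_mul]
    exact tsum_congr fun b => by rw [ih]

lemma enorm_app_le (K : α → α → ℂ) (f : α → ℂ) (a : α) :
    ‖app K f a‖ₑ ≤ appE K (fun b => ‖f b‖ₑ) a :=
  (enorm_tsum_le_tsum_enorm).trans (by simp [appE])

lemma appE_mono_right (K : α → α → ℂ) {f g : α → ℝ≥0∞} (hf : ∀ b, f b ≤ g b) (a : α) :
    appE K f a ≤ appE K g a := appE_mono (fun _ => le_rfl) fun b _ => hf b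

lemma enorm_foldr_app_le (Ks : List (α → α → ℂ)) (f : α → ℂ) (a : α) :
    ‖Ks.foldr app f a‖ₑ ≤ Ks.foldr appE (fun b => ‖f b‖ₑ) a := by
  induction Ks generalizing a with
  | nil => exact le_rfl
  | cons K Ks ih => exact (enorm_app_le _ _ _).trans (appE_mono_right K ih a)

lemma summable_of_tsum_enorm_ne_top {ι : Type*} {f : ι → ℂ} (h : ∑' i, ‖f i‖ₑ ≠ ∞) :
    Summable f :=
  Summable.of_norm (by simpa using ENNReal.summable_toReal h)

lemma app_app_comm (K : α → α → ℂ) (L : β → β → ℂ) (F : α → β → ℂ) (a : α) (b : β)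
    (h : appE K (fun a' => appE L (fun b' => ‖F a' b'‖ₑ) b) a ≠ ∞) :
    app K (fun a' => app L (F a') b) a = app L (fun b' => app K (fun a' => F a' b') a) b := by
  have hs : Summable fun p : α × β => K a p.1 * (L b p.2 * F p.1 p.2) := by
    refine summable_of_tsum_enorm_ne_top ?_
    rw [ENNReal.tsum_prod (f := fun a' b' => ‖K a a' * (L b b' * F a' b')‖ₑ)]
    simpa [appE, enorm_mul, ENNReal.tsum_mul_left] using h
  simp only [app, ← tsum_mul_left]
  rw [← Summable.tsum_comm (f := fun a' b' => K a a' * (L b b' * F a' b')) hs]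
  exact tsum_congr fun b' => tsum_congr fun a' => by ring

/-- Fubini, one operator of the composition at a time: operators in separate variables commute once
the iterated sum of absolute values is finite. -/
lemma app_foldr_comm (K : α → α → ℂ) (Ls : List (β → β → ℂ)) (F : α → β → ℂ) (a : α) (b : β)
    (h : appE K (fun a' => Ls.foldr appE (fun b' => ‖F a' b'‖ₑ) b) a ≠ ∞) :
    app K (fun a' => Ls.foldr app (F a') b) a
      = Ls.foldr app (fun b' => app K (fun a' => F a' b') a) b := by
  induction Ls generalizing b with
  | nil => rfl
  | cons L Ls ih =>
    simp only [List.foldr_cons] at h ⊢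
    rw [app_app_comm K L (fun a' b' => Ls.foldr app (F a') b') a b]
    · refine tsum_congr fun b' => ?_
      -- Finiteness at `b'` can be read off from the total only if `b'` enters with a nonzero
      -- weight; otherwise the term vanishes anyway.
      by_cases hL : L b b' = 0
      · simp [hL]
      · refine congrArg (L b b' * ·) (ih b' ?_)
        intro htop
        refine h (top_unique ?_)
        have : ‖L b b'‖ₑ * appE K (fun a' => Ls.foldr appE (fun b' => ‖F a' b'‖ₑ) b') a = ∞ := by
          rw [htop]
          exact ENNReal.mul_top (by simpa using hL)
        rw [← this, ← appE_const_mul]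
        exact appE_mono_right K
          (fun a' => ENNReal.le_tsum (f := fun b' => ‖L b b'‖ₑ * _) b') a
    · exact ne_top_of_le_ne_top h (appE_mono_right K
        (fun a' => appE_mono_right L (fun b' => enorm_foldr_app_le _ _ _) _) _)

end Kernel

/-! ### Bounds for the kernels -/

/-- Only the start of a path can be `0`: arrows `→z` strictly increase the index and `↑` keeps it.
-/
lemma one_le_of_kerR_ne_zero {ℓ : Letter} {m n : ℕ} (h : kerR x ℓ m n ≠ 0)
    (hm : 1 ≤ m ∨ ℓ.IsArr) : 1 ≤ n := by
  cases ℓ with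
  | up =>
    by_contra hn
    simp only [kerR, ne_eq, ite_eq_right_iff, not_forall, Letter.IsArr, or_false] at h hm
    obtain ⟨h, -⟩ := h
    omega
  | arr z =>
    by_contra hn
    simp only [kerR, ne_eq, ite_eq_right_iff, not_forall] at h
    obtain ⟨h, -⟩ := h
    omega

lemma one_le_of_kerL_ne_zero {ℓ : Letter} {m n : ℕ} (h : kerL x ℓ m n ≠ 0)
    (hm : 1 ≤ m ∨ ℓ.IsArr) : 1 ≤ n := by
  cases ℓ with
  | up => exact one_le_of_kerR_ne_zero (x := x) (ℓ := .up) h hm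
  | arr z =>
    by_contra hn
    simp only [kerL, ne_eq, ite_eq_right_iff, not_forall] at h
    obtain ⟨h, -⟩ := h
    omega

lemma poch_div_factorial_antitone (h0 : 0 ≤ x) (hx : x < 1) :
    Antitone fun n => poch x n / n.factorial :=
  antitone_nat_of_succ_le fun n => by
    have h1 := poch_pos hx n
    have h3 : (0 : ℝ) < n.factorial := by exact_mod_cast n.factorial_pos
    rw [poch_succ, Nat.factorial_succ]
    push_cast
    rw [div_le_div_iff₀ (by positivity) h3]
    nlinarith [mul_pos h1 h3, mul_nonneg h0 (mul_pos h1 h3).le]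

lemma poch_div_mul_eq_inv (hx : x < 1) (n : ℕ) :
    poch x n / n.factorial * (n.factorial / poch x (n + 1)) = ((n + 1 : ℕ) - x)⁻¹ := by
  have h1 := (poch_pos hx n).ne'
  have h2 := (natCast_sub_pos hx (Nat.succ_pos n)).ne'
  have h3 : (n.factorial : ℝ) ≠ 0 := by exact_mod_cast n.factorial_pos.ne'
  rw [poch_succ]
  push_cast at h2 ⊢
  field_simp

/-- The extra factors `i / (i - x)` are at least `1`. Consequently `kerL` is dominated by `kerR`,
and convergence needs to be studied only for the latter. -/
lemma inv_le_ratio (h0 : 0 ≤ x) (hx : x < 1) {m n : ℕ} (h : m < n) :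
    ((n : ℝ) - x)⁻¹ ≤ ratio x m n := by
  obtain ⟨n, rfl⟩ := Nat.exists_eq_add_of_le' (show 1 ≤ n by omega)
  rw [← poch_div_mul_eq_inv hx, ratio, Nat.add_sub_cancel]
  have h1 := poch_pos hx (n + 1)
  exact mul_le_mul_of_nonneg_right (poch_div_factorial_antitone h0 hx (by omega)) (by positivity)

lemma ratio_pos (hx : x < 1) (m n : ℕ) : 0 < ratio x m n := by
  have h1 := poch_pos hx m
  have h2 := poch_pos hx n
  have h3 : (0 : ℝ) < m.factorial := by exact_mod_cast m.factorial_pos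
  have h4 : (0 : ℝ) < (n - 1).factorial := by exact_mod_cast (n - 1).factorial_pos
  unfold ratio
  positivity

lemma inv_le_weightR (h0 : 0 ≤ x) (hx : x < 1) (z : ℂ) {m n : ℕ} (h : m < n) :
    ((n : ℝ) - x)⁻¹ ≤ weightR x z m n := by
  unfold weightR
  split_ifs
  · exact le_rfl
  · exact inv_le_ratio h0 hx h

lemma enorm_ofReal_of_nonneg {r : ℝ} (h : 0 ≤ r) : ‖(r : ℂ)‖ₑ = ENNReal.ofReal r := by
  rw [← ofReal_norm, Complex.norm_real, Real.norm_of_nonneg h]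

lemma enorm_kerL_le (h0 : 0 ≤ x) (hx : x < 1) (ℓ : Letter) (m n : ℕ) :
    ‖kerL x ℓ m n‖ₑ ≤ ‖kerR x ℓ m n‖ₑ := by
  cases ℓ with
  | up => exact le_rfl
  | arr z =>
    by_cases h : m < n
    · have h1 := natCast_sub_pos hx (show 1 ≤ n by omega)
      have h2 := inv_le_weightR h0 hx z h
      simp only [kerL, kerR, if_pos h, enorm_mul]
      rw [enorm_ofReal_of_nonneg (inv_nonneg.2 h1.le),
        enorm_ofReal_of_nonneg ((inv_nonneg.2 h1.le).trans h2)]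
      gcongr
    · simp [kerL, h]

/-- The connector as an extended nonnegative number. -/
noncomputable def connE (x : ℝ) (n m : ℕ) : ℝ≥0∞ := ENNReal.ofReal (conn x n m)

lemma enorm_conn (hx : x < 1) (n m : ℕ) : ‖(conn x n m : ℂ)‖ₑ = connE x n m :=
  enorm_ofReal_of_nonneg (conn_pos hx n m).le

lemma enorm_pow_mul_le {z : ℂ} (hz : ‖z‖ ≤ 1) (k : ℕ) {r : ℝ} (hr : 0 ≤ r) :
    ‖z ^ k * (r : ℂ)‖ₑ ≤ ENNReal.ofReal r := by
  rw [← ofReal_norm, norm_mul, norm_pow, Complex.norm_real, Real.norm_of_nonneg hr]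
  exact ENNReal.ofReal_le_ofReal (mul_le_of_le_one_left hr (pow_le_one₀ (norm_nonneg z) hz))

/-- For `z = 1` the sum of absolute values telescopes exactly to `conn x n m / n`; for `z ≠ 1` it is
a beta series in the second variable, bounded by `tsum_bet_right_le`. The factor `1 / n` is kept for
the start at `m = 0`. -/
lemma appE_kerR_arr_connE_le (h0 : 0 ≤ x) (hx : x < 1) {z : ℂ} (hz : ‖z‖ ≤ 1) (n m : ℕ)
    (hn : 1 ≤ n) :
    appE (kerR x (.arr z)) (connE x n) m ≤ ENNReal.ofReal ((1 - x)⁻¹ * (conn x n m / n)) := by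
  have hn' : (1 : ℝ) ≤ n := by exact_mod_cast hn
  have hc := conn_pos hx n m
  have hxi : 1 ≤ (1 - x)⁻¹ := (one_le_inv₀ (by linarith)).2 (by linarith)
  have key : ∀ S : ℝ, HasSum (fun k => weightR x z m (m + 1 + k) * conn x n (m + 1 + k)) S →
      S ≤ (1 - x)⁻¹ * (conn x n m / n) →
      appE (kerR x (.arr z)) (connE x n) m ≤ ENNReal.ofReal ((1 - x)⁻¹ * (conn x n m / n)) := by
    intro S hS hle
    have hw : ∀ k, 0 ≤ weightR x z m (m + 1 + k) := fun k =>
      (inv_nonneg.2 (natCast_sub_pos hx (by omega)).le).trans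
        (inv_le_weightR h0 hx z (show m < m + 1 + k by omega))
    refine le_trans ?_ (ENNReal.ofReal_le_ofReal hle)
    rw [appE_kerR_arr, ← hS.tsum_eq,
      ENNReal.ofReal_tsum_of_nonneg (fun k => mul_nonneg (hw k) (conn_pos hx _ _).le) hS.summable]
    refine ENNReal.tsum_le_tsum fun k => ?_
    rw [ENNReal.ofReal_mul (hw k), connE]
    exact mul_le_mul' (enorm_pow_mul_le hz _ (hw k)) le_rfl
  by_cases h1 : z = 1
  · refine key (conn x n m / n) ?_ (le_mul_of_one_le_left (by positivity) hxi)
    have := hasSum_inv_mul_conn hx m n hn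
    simp only [weightR, if_pos h1]
    rw [conn_comm n m]
    refine this.congr_fun fun k => ?_
    rw [conn_comm]
  · obtain ⟨n, rfl⟩ := Nat.exists_eq_add_of_le' hn
    have hs := ((summable_bet_right hx n m).hasSum.mul_left (poch x m / m.factorial))
    refine key _ (hs.congr_fun fun k => ?_) ?_
    · simp only [weightR, if_neg h1]
      exact ratio_mul_conn hx (n + 1) m k
    · have hp : 0 ≤ poch x m / m.factorial := by
        have := poch_pos hx m
        positivity
      refine (mul_le_mul_of_nonneg_left (tsum_bet_right_le hx n m) hp).trans ?_
      rw [← inv_mul_conn_succ hx, div_eq_inv_mul, ← mul_assoc]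
      refine mul_le_mul_of_nonneg_right ?_ hc.le
      rw [← mul_inv]
      have h2 : 0 < 1 - x := by linarith
      -- With the old `n` equal to `n + 1`, this is `(1 - x) * (n + 1) ≤ n + 1 - x`.
      refine inv_anti₀ (by positivity) ?_
      nlinarith

lemma one_le_ofReal_inv (h0 : 0 ≤ x) (hx : x < 1) : 1 ≤ ENNReal.ofReal (1 - x)⁻¹ := by
  rw [ENNReal.one_le_ofReal]
  exact (one_le_inv₀ (by linarith)).2 (by linarith)

lemma enorm_natCast_inv_le_one {m : ℕ} (hm : 1 ≤ m) : ‖((m : ℂ))⁻¹‖ₑ ≤ 1 := by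
  have : (1 : ℝ) ≤ m := by exact_mod_cast hm
  rw [← ofReal_norm, norm_inv, Complex.norm_natCast]
  exact (ENNReal.ofReal_le_ofReal (inv_le_one_of_one_le₀ this)).trans (by simp)

/-- The bound reproduces the connector with a constant independent of `n` and `m`, so it can be
iterated along a whole word. -/
lemma appE_kerR_connE_le (h0 : 0 ≤ x) (hx : x < 1) {ℓ : Letter} (hℓ : ℓ.NormLe) {n m : ℕ}
    (hn : 1 ≤ n) (hm : 1 ≤ m ∨ ℓ.IsArr) :
    appE (kerR x ℓ) (connE x n) m ≤ ENNReal.ofReal (1 - x)⁻¹ * connE x n m := by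
  cases ℓ with
  | up =>
    rw [appE_kerR_up]
    exact mul_le_mul' ((enorm_natCast_inv_le_one (hm.resolve_right id)).trans
      (one_le_ofReal_inv h0 hx)) le_rfl
  | arr z =>
    have h2 : 0 ≤ (1 - x)⁻¹ := inv_nonneg.2 (by linarith)
    have hn' : (1 : ℝ) ≤ n := by exact_mod_cast hn
    refine (appE_kerR_arr_connE_le h0 hx hℓ n m hn).trans ?_
    rw [connE, ← ENNReal.ofReal_mul h2]
    exact ENNReal.ofReal_le_ofReal
      (mul_le_mul_of_nonneg_left (div_le_self (conn_pos hx n m).le hn') h2)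

lemma foldr_appE_kerR_le (h0 : 0 ≤ x) (hx : x < 1) {n : ℕ} (hn : 1 ≤ n) {f : ℕ → ℝ≥0∞}
    {K : ℝ≥0∞} (hf : ∀ m, 1 ≤ m → f m ≤ K * connE x n m) (W : List Letter)
    (hW : ∀ ℓ ∈ W, ℓ.NormLe) (m : ℕ) (hm : 1 ≤ m) :
    (W.map (kerR x)).foldr appE f m
      ≤ ENNReal.ofReal (1 - x)⁻¹ ^ W.length * K * connE x n m := by
  induction W generalizing m with
  | nil => simpa using hf m hm
  | cons ℓ W ih =>
    simp only [List.map_cons, List.foldr_cons, List.length_cons]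
    refine (appE_mono (fun _ => le_rfl) fun b hb =>
      ih (fun ℓ' h => hW ℓ' (List.mem_cons_of_mem _ h)) b
        (one_le_of_kerR_ne_zero hb (Or.inl hm))).trans ?_
    rw [appE_const_mul, pow_succ, mul_assoc (_ ^ _), mul_assoc (_ ^ _), mul_assoc (_ ^ _)]
    refine mul_le_mul' le_rfl ?_
    rw [mul_comm (ENNReal.ofReal _) K, mul_assoc]
    exact mul_le_mul' le_rfl
      (appE_kerR_connE_le h0 hx (hW ℓ List.mem_cons_self) hn (Or.inl hm))

/-- Each further factor `i / (i - x)` is at most `(1 - x)⁻¹`. This growth is the origin of the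
threshold `1 - x` in `Letter.LastOK`. -/
lemma ratio_mul_pow_le (h0 : 0 ≤ x) (hx : x < 1) (m k : ℕ) :
    ratio x m (m + 1 + k) * (1 - x) ^ k ≤ ((m : ℝ) + 1 - x)⁻¹ := by
  induction k with
  | zero =>
    have h := poch_div_mul_eq_inv hx m
    simp only [add_zero, pow_zero, mul_one, ratio, Nat.add_sub_cancel, h]
    push_cast
    exact le_rfl
  | succ k ih =>
    refine le_trans ?_ ih
    have h2 := natCast_sub_pos hx (show 1 ≤ m + k + 2 by omega)
    have h1 := poch_pos hx (m + k + 1)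
    have e : ratio x m (m + 1 + (k + 1))
        = ratio x m (m + 1 + k) * ((m + k + 1) / ((m + k + 2 : ℕ) - x)) := by
      rw [ratio, ratio, show m + 1 + (k + 1) = (m + k + 1) + 1 by ring, poch_succ,
        show m + 1 + k = m + k + 1 by ring, Nat.add_sub_cancel, Nat.add_sub_cancel,
        Nat.factorial_succ]
      have h3 : (m.factorial : ℝ) ≠ 0 := by exact_mod_cast m.factorial_pos.ne'
      push_cast at h2 ⊢
      have h4 : (m : ℝ) + k + 1 + 1 - x ≠ 0 := by linarith
      have h5 : (m : ℝ) + k + 2 - x ≠ 0 := h2.ne'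
      field_simp
      ring
    rw [e, pow_succ, mul_mul_mul_comm]
    refine mul_le_of_le_one_right
      (mul_nonneg (ratio_pos hx _ _).le (pow_nonneg (by linarith) k)) ?_
    rw [div_mul_eq_mul_div, div_le_one h2]
    push_cast
    nlinarith [m.cast_nonneg (α := ℝ), k.cast_nonneg (α := ℝ),
      mul_nonneg h0 (m.cast_nonneg (α := ℝ)), mul_nonneg h0 (k.cast_nonneg (α := ℝ))]

/-- The innermost function is the constant `1`, which carries no decay. A last arrow `↑` supplies `1
/ m`, and `→z` a geometric series of ratio `‖z‖ / (1 - x)`; both are comparable with `conn x 1 m =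
(1 - x) / (m + 1 - x)`. -/
lemma exists_appE_kerR_one_le (h0 : 0 < x) (hx : x < 1) {ℓ : Letter} (hℓ : ℓ.LastOK x) :
    ∃ K : ℝ≥0∞, K ≠ ∞ ∧ ∀ m, 1 ≤ m ∨ ℓ.IsArr →
      appE (kerR x ℓ) (fun _ => 1) m ≤ K * connE x 1 m := by
  have hx1 : 0 < 1 - x := by linarith
  cases ℓ with
  | up =>
    -- The `2` comes from `m + 1 - x ≤ 2 * m`, the `1 - x` from the numerator of `conn x 1 m`.
    refine ⟨ENNReal.ofReal (2 / (1 - x)), ENNReal.ofReal_ne_top, fun m hm => ?_⟩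
    have hm : (1 : ℝ) ≤ m := by exact_mod_cast hm.resolve_right id
    rw [appE_kerR_up, mul_one, connE, ← ENNReal.ofReal_mul (by positivity),
      ← ofReal_norm, norm_inv, Complex.norm_natCast, conn_one_left hx]
    refine ENNReal.ofReal_le_ofReal ?_
    rw [div_mul_div_comm, inv_eq_one_div, div_le_div_iff₀ (by positivity)
      (mul_pos hx1 (by linarith))]
    nlinarith
  | arr z =>
    have hz : ‖z‖ < 1 - x := hℓ
    have hz1 : z ≠ 1 := fun h => by
      rw [h, norm_one] at hz
      linarith
    set q := ‖z‖ / (1 - x) with hq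
    have hq0 : 0 ≤ q := by positivity
    have hq1 : q < 1 := (div_lt_one hx1).2 hz
    refine ⟨ENNReal.ofReal ((1 - x)⁻¹ * (1 - q)⁻¹), ENNReal.ofReal_ne_top, fun m _ => ?_⟩
    have hm : 0 < (m : ℝ) + 1 - x := by
      have := m.cast_nonneg (α := ℝ)
      linarith
    have hs := (hasSum_geometric_of_lt_one hq0 hq1).mul_right ((m : ℝ) + 1 - x)⁻¹
    have e : (1 - x)⁻¹ * (1 - q)⁻¹ * conn x 1 m = (1 - q)⁻¹ * ((m : ℝ) + 1 - x)⁻¹ := by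
      rw [conn_one_left hx]
      field_simp
    rw [connE, ← ENNReal.ofReal_mul (mul_nonneg (by positivity)
      (inv_nonneg.2 (by linarith))), e, ← hs.tsum_eq,
      ENNReal.ofReal_tsum_of_nonneg (fun k => by positivity) hs.summable, appE_kerR_arr]
    refine ENNReal.tsum_le_tsum fun k => ?_
    rw [mul_one, ← ofReal_norm, norm_mul, norm_pow, Complex.norm_real, weightR,
      if_neg hz1, Real.norm_of_nonneg (ratio_pos hx _ _).le]
    refine ENNReal.ofReal_le_ofReal ?_
    have h1 := ratio_mul_pow_le h0.le hx m k
    have h2 : ‖z‖ ^ (k + 1) ≤ q ^ k * (1 - x) ^ k := by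
      rw [← mul_pow, hq, div_mul_cancel₀ _ hx1.ne', pow_succ]
      exact mul_le_of_le_one_right (by positivity) (by linarith)
    calc ‖z‖ ^ (k + 1) * ratio x m (m + 1 + k)
        ≤ q ^ k * (1 - x) ^ k * ratio x m (m + 1 + k) :=
          mul_le_mul_of_nonneg_right h2 (ratio_pos hx _ _).le
      _ = q ^ k * (ratio x m (m + 1 + k) * (1 - x) ^ k) := by ring
      _ ≤ q ^ k * ((m : ℝ) + 1 - x)⁻¹ := mul_le_mul_of_nonneg_left h1 (by positivity)

/-- Absolute convergence. -/
lemma foldr_appE_kerR_one_ne_top (h0 : 0 < x) (hx : x < 1) (W : List Letter)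
    (hW : ∀ ℓ ∈ W, ℓ.NormLe) (hhead : ∀ ℓ ∈ W.head?, ℓ.IsArr)
    (hlast : ∀ ℓ ∈ W.getLast?, ℓ.LastOK x) :
    (W.map (kerR x)).foldr appE (fun _ => 1) 0 ≠ ∞ := by
  rcases List.eq_nil_or_concat W with rfl | ⟨V, ℓ, rfl⟩
  · simp
  · obtain ⟨K, hK, h⟩ := exists_appE_kerR_one_le h0 hx (hlast ℓ (by simp))
    rw [List.concat_eq_append, List.map_append, List.foldr_append]
    simp only [List.concat_eq_append] at hW hhead
    cases V with
    | nil =>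
      refine ne_top_of_le_ne_top (ENNReal.mul_ne_top hK ENNReal.ofReal_ne_top)
        (h 0 (Or.inr (hhead ℓ (by simp))))
    | cons v V =>
      have hv : v.IsArr := hhead v (by simp)
      simp only [List.map_cons, List.foldr_cons, List.map_nil, List.foldr_nil]
      refine ne_top_of_le_ne_top ?_ (appE_mono (fun _ => le_rfl) fun b hb =>
        foldr_appE_kerR_le h0.le hx le_rfl (fun m hm => h m (Or.inl hm)) V
          (fun ℓ' h' => hW ℓ' (by simp [h'])) b (one_le_of_kerR_ne_zero hb (Or.inr hv)))
      rw [appE_const_mul]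
      refine ENNReal.mul_ne_top (ENNReal.mul_ne_top (ENNReal.pow_ne_top ENNReal.ofReal_ne_top) hK)
        (ne_top_of_le_ne_top ?_ (appE_kerR_connE_le h0.le hx (hW v (by simp)) le_rfl
          (Or.inr hv)))
      exact ENNReal.mul_ne_top ENNReal.ofReal_ne_top ENNReal.ofReal_ne_top

/-! ### Transport of all arrows -/

/-- As `x > 0`, the arrow `→1` is excluded. Thus admissibility at the end of a word makes the dual
word start with some `→w`, as it must when starting from `0`. -/
lemma Letter.LastOK.isArr_dual {ℓ : Letter} (h0 : 0 < x) (h : ℓ.LastOK x) : ℓ.dual.IsArr := by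
  cases ℓ with
  | up => trivial
  | arr z =>
    have hz : ‖z‖ < 1 - x := h
    have hz1 : z ≠ 1 := fun h => by
      rw [h, norm_one] at hz
      linarith
    simp [Letter.dual, hz1, Letter.IsArr]

lemma Letter.isArr_of_lastOK_dual {ℓ : Letter} (h0 : 0 < x) (h : ℓ.dual.LastOK x) : ℓ.IsArr := by
  cases ℓ with
  | up =>
    have h1 : ‖(1 : ℂ)‖ < 1 - x := h
    rw [norm_one] at h1
    linarith
  | arr z => trivial

lemma Letter.Valid.normLe {ℓ : Letter} (h : ℓ.Valid) : ℓ.NormLe := by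
  cases ℓ with
  | up => trivial
  | arr z =>
    rcases h with rfl | h
    · simp [Letter.NormLe]
    · exact h.1

lemma Letter.Valid.normLe_dual {ℓ : Letter} (h : ℓ.Valid) : ℓ.dual.NormLe := by
  cases ℓ with
  | up => simp [Letter.dual, Letter.NormLe]
  | arr z =>
    by_cases hz : z = 1
    · simp [Letter.dual, hz, Letter.NormLe]
    · simp only [Letter.dual, if_neg hz]
      exact (h.resolve_left hz).2

/-- The word dual to a given one. -/
noncomputable def dualWord (W : List Letter) : List Letter := (W.map Letter.dual).reverse

lemma foldr_app_kerR_congr {f g : ℕ → ℂ} (V : List Letter) (m : ℕ)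
    (h : ∀ k, 1 ≤ k → f k = g k) (h' : V = [] → f m = g m)
    (hm : 1 ≤ m ∨ ∀ v ∈ V.head?, v.IsArr) :
    (V.map (kerR x)).foldr app f m = (V.map (kerR x)).foldr app g m := by
  induction V generalizing m with
  | nil => exact h' rfl
  | cons v V ih =>
    refine tsum_congr fun b => ?_
    by_cases hb : kerR x v m b = 0
    · simp [hb]
    · have hb' := one_le_of_kerR_ne_zero hb (hm.imp id fun h => h v rfl)
      rw [ih b (fun _ => h b hb') (Or.inl hb')]

/-- The bound needed for Fubini must again be a connector in `n`, with positive second argument, so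
that one more arrow can act on it. Starting from `m = 0` this requires moving to `m' = 1`. -/
lemma exists_foldr_appE_kerR_le (h0 : 0 ≤ x) (hx : x < 1) (V : List Letter) (hV : V ≠ [])
    (hn : ∀ v ∈ V, v.NormLe) (m : ℕ) (hm : 1 ≤ m ∨ ∀ v ∈ V.head?, v.IsArr) :
    ∃ K : ℝ≥0∞, K ≠ ∞ ∧ ∃ m', 1 ≤ m' ∧ ∀ n, 1 ≤ n →
      (V.map (kerR x)).foldr appE (connE x n) m ≤ K * connE x n m' := by
  have hk : ∀ j : ℕ, ENNReal.ofReal (1 - x)⁻¹ ^ j * 1 ≠ ∞ := fun j => by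
    rw [mul_one]
    exact ENNReal.pow_ne_top ENNReal.ofReal_ne_top
  by_cases h : 1 ≤ m
  · exact ⟨_, hk V.length, m, h, fun n hn' => foldr_appE_kerR_le h0 hx hn'
      (K := 1) (fun m _ => by rw [one_mul]) V hn m h⟩
  · obtain rfl : m = 0 := by omega
    cases V with
    | nil => exact absurd rfl hV
    | cons v V =>
      have hv : v.IsArr := hm.resolve_left h v rfl
      cases v with
      | up => exact hv.elim
      | arr z =>
        have hx1 : 0 < 1 - x := by linarith
        -- The first arrow out of `0` leaves `(1 - x)⁻¹ / n`, since `conn x n 0 = 1`. The constant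
        -- compares this with `conn x n 1 = (1 - x) / (n + 1 - x)` through `1 / n ≤ 2 / (n + 1 -
        -- x)`.
        refine ⟨_, ENNReal.mul_ne_top (hk V.length)
          (ENNReal.ofReal_ne_top (r := 2 * ((1 - x)⁻¹ * (1 - x)⁻¹))), 1, le_rfl,
          fun n hn' => ?_⟩
        simp only [List.map_cons, List.foldr_cons]
        refine (appE_mono (fun _ => le_rfl) fun b hb =>
          foldr_appE_kerR_le h0 hx hn' (K := 1) (fun m _ => by rw [one_mul]) V
            (fun ℓ' h' => hn ℓ' (by simp [h'])) b (one_le_of_kerR_ne_zero hb (Or.inr hv))).trans ?_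
        rw [appE_const_mul, mul_assoc (_ * 1) (ENNReal.ofReal _)]
        refine mul_le_mul' le_rfl ?_
        refine (appE_kerR_arr_connE_le h0 hx (hn (.arr z) (by simp)) n 0 hn').trans ?_
        rw [connE, ← ENNReal.ofReal_mul (by positivity)]
        refine ENNReal.ofReal_le_ofReal ?_
        have hn1 : (1 : ℝ) ≤ n := by exact_mod_cast hn'
        have hn2 : 0 < (n : ℝ) + 1 - x := by linarith
        rw [conn_comm n 1, conn_one_left hx, conn_zero_right hx]
        have e : 2 * ((1 - x)⁻¹ * (1 - x)⁻¹) * ((1 - x) / ((n : ℝ) + 1 - x))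
            = (1 - x)⁻¹ * (2 / ((n : ℝ) + 1 - x)) := by
          field_simp
        rw [e]
        refine mul_le_mul_of_nonneg_left ?_ (by positivity)
        rw [div_le_div_iff₀ (by linarith) hn2]
        linarith

/-- The connected sums before and after the transport of all arrows agree. -/
theorem foldr_app_kerL_conn (h0 : 0 < x) (hx : x < 1) (W : List Letter)
    (hW : ∀ ℓ ∈ W, ℓ.Valid) (n m : ℕ) (hn : 1 ≤ n ∨ ∀ ℓ ∈ W.head?, ℓ.dual.LastOK x)
    (hm : 1 ≤ m ∨ ∀ ℓ ∈ W.getLast?, ℓ.LastOK x) :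
    (W.map (kerL x)).foldr app (fun n => (conn x n m : ℂ)) n
      = (W.map Letter.sign).prod *
        ((dualWord W).map (kerR x)).foldr app (fun m => (conn x n m : ℂ)) m := by
  induction W generalizing n with
  | nil => simp [dualWord]
  | cons ℓ W ih =>
    have hW' : ∀ ℓ' ∈ W, ℓ'.Valid := fun ℓ' h => hW ℓ' (List.mem_cons_of_mem _ h)
    have hn' : 1 ≤ n ∨ ℓ.IsArr :=
      hn.imp id fun h => Letter.isArr_of_lastOK_dual h0 (h ℓ rfl)
    have hlast : 1 ≤ m ∨ ∀ ℓ ∈ W.getLast?, ℓ.LastOK x := by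
      refine hm.imp id fun h ℓ' hℓ' => h ℓ' ?_
      rw [List.getLast?_cons]
      simp only [Option.mem_def] at hℓ' ⊢
      simp [hℓ']
    have hhead : 1 ≤ m ∨ ∀ v ∈ (dualWord W).head?, v.IsArr := by
      refine hlast.imp id fun h v hv => ?_
      rw [dualWord, List.head?_reverse, List.getLast?_map] at hv
      simp only [Option.mem_def, Option.map_eq_some_iff] at hv
      obtain ⟨ℓ', hℓ', rfl⟩ := hv
      exact (h ℓ' hℓ').isArr_dual h0
    have hnorm : ∀ v ∈ dualWord W, v.NormLe := fun v hv => by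
      simp only [dualWord, List.mem_reverse, List.mem_map] at hv
      obtain ⟨ℓ', hℓ', rfl⟩ := hv
      exact (hW' ℓ' hℓ').normLe_dual
    have step1 : ((ℓ :: W).map (kerL x)).foldr app (fun n => (conn x n m : ℂ)) n
        = app (kerL x ℓ) (fun n' => (W.map Letter.sign).prod *
          ((dualWord W).map (kerR x)).foldr app (fun m => (conn x n' m : ℂ)) m) n := by
      refine tsum_congr fun b => ?_
      by_cases hb : kerL x ℓ n b = 0
      · simp [hb]
      · exact congrArg _ (ih hW' b (Or.inl (one_le_of_kerL_ne_zero hb hn')) hlast)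
    -- The remaining arrow acts in `n` and the transported ones in `m`; they are exchanged so that
    -- it meets the connector directly. By symmetry of the connector, the convergence bound is
    -- `appE_kerR_connE_le` with the variables swapped.
    have step2 : app (kerL x ℓ) (fun n' =>
          ((dualWord W).map (kerR x)).foldr app (fun m => (conn x n' m : ℂ)) m) n
        = ((dualWord W).map (kerR x)).foldr app
          (fun m' => app (kerL x ℓ) (fun n' => (conn x n' m' : ℂ)) n) m := by
      by_cases hV : dualWord W = []
      · simp [hV]
      · refine app_foldr_comm (kerL x ℓ) _ (fun n' m' => (conn x n' m' : ℂ)) n m ?_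
        obtain ⟨K, hK, m', hm', hle⟩ := exists_foldr_appE_kerR_le h0.le hx _ hV hnorm m hhead
        simp only [enorm_conn hx]
        refine ne_top_of_le_ne_top ?_ (appE_mono (enorm_kerL_le h0.le hx ℓ n)
          (g := fun n' => K * connE x m' n') fun b hb => ?_)
        · rw [appE_const_mul]
          refine ENNReal.mul_ne_top hK (ne_top_of_le_ne_top ?_ (appE_kerR_connE_le h0.le hx
            (hW ℓ List.mem_cons_self).normLe hm' hn'))
          exact ENNReal.mul_ne_top ENNReal.ofReal_ne_top ENNReal.ofReal_ne_top
        · refine (hle b (one_le_of_kerL_ne_zero hb hn')).trans (le_of_eq ?_)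
          rw [connE, connE, conn_comm]
    -- Transport takes place at the index reached after all of `dualWord W`. That index is positive
    -- unless the word is empty, in which case it is `m` itself and the condition on the last arrow
    -- is used.
    have step3 : ((dualWord W).map (kerR x)).foldr app
          (fun m' => app (kerL x ℓ) (fun n' => (conn x n' m' : ℂ)) n) m
        = ((dualWord W).map (kerR x)).foldr app
          (fun m' => ℓ.sign * app (kerR x ℓ.dual) (fun m => (conn x n m : ℂ)) m') m := by
      have hn2 := hn.imp id fun h => h ℓ rfl
      have hv := hW ℓ List.mem_cons_self
      refine foldr_app_kerR_congr _ m (fun k hk =>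
        app_kerL_conn_eq_app_kerR_conn h0 hx ℓ hv n k hn2 (Or.inl hk)) (fun hV => ?_) hhead
      have hWn : W = [] := by simpa [dualWord] using hV
      subst hWn
      exact app_kerL_conn_eq_app_kerR_conn h0 hx ℓ hv n m hn2 (hm.imp id fun h => h ℓ rfl)
    rw [step1, app_const_mul, step2, step3, foldr_app_const_mul]
    simp only [dualWord, List.map_cons, List.reverse_cons, List.map_append, List.foldr_append,
      List.prod_cons, List.map_nil, List.foldr_cons, List.foldr_nil]
    ring

/-! ### Sums over paths -/

section Path

variable {α : Type*}

lemma consEquiv_apply' {r : ℕ} (p : α × (Fin r → α)) :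
    Fin.consEquiv (fun _ : Fin (r + 1) => α) p = (Fin.cons p.1 p.2 : Fin (r + 1) → α) := rfl

/-- The product of the kernels along a path starting at `a`. -/
noncomputable def pathProd {r : ℕ} (K : Fin r → α → α → ℂ) (a : α) (s : Fin r → α) : ℂ :=
  ∏ i, K i ((Fin.cons a s : Fin (r + 1) → α) i.castSucc) (s i)

lemma pathProd_cons {r : ℕ} (K : Fin (r + 1) → α → α → ℂ) (a b : α) (s : Fin r → α) :
    pathProd K a (Fin.cons b s : Fin (r + 1) → α) = K 0 a b * pathProd (fun i => K i.succ) b s := by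
  rw [pathProd, Fin.prod_univ_succ]
  simp [pathProd]

lemma tsum_enorm_pathProd {r : ℕ} (K : Fin r → α → α → ℂ) (a : α) :
    ∑' s, ‖pathProd K a s‖ₑ = (List.ofFn K).foldr appE (fun _ => 1) a := by
  induction r generalizing a with
  | zero => simp [pathProd]
  | succ r ih =>
    rw [← (Fin.consEquiv fun _ : Fin (r + 1) => α).tsum_eq, ENNReal.tsum_prod']
    simp only [consEquiv_apply', pathProd_cons, enorm_mul, ENNReal.tsum_mul_left, ih,
      List.ofFn_succ, List.foldr_cons]
    rfl

/-- Peeling off the first step and applying Fubini turns the sum over all tuples into nested sums.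
Tuples are unrestricted here; monotonicity is enforced by vanishing kernels. -/
lemma hasSum_pathProd {r : ℕ} (K : Fin r → α → α → ℂ) (a : α)
    (h : (List.ofFn K).foldr appE (fun _ => 1) a ≠ ∞) :
    HasSum (pathProd K a) ((List.ofFn K).foldr app (fun _ => 1) a) := by
  have hs : Summable (pathProd K a) := summable_of_tsum_enorm_ne_top (by rwa [tsum_enorm_pathProd])
  refine hs.hasSum_iff.2 ?_
  induction r generalizing a with
  | zero => simp [pathProd]
  | succ r ih =>
    have hs' : Summable fun p : α × (Fin r → α) =>
        K 0 a p.1 * pathProd (fun i => K i.succ) p.1 p.2 := by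
      have := (Fin.consEquiv fun _ : Fin (r + 1) => α).summable_iff.2 hs
      refine this.congr fun p => ?_
      simp [consEquiv_apply', pathProd_cons]
    rw [← (Fin.consEquiv fun _ : Fin (r + 1) => α).tsum_eq]
    simp only [consEquiv_apply', pathProd_cons]
    rw [hs'.tsum_prod]
    simp only [List.ofFn_succ, List.foldr_cons] at h ⊢
    refine tsum_congr fun b => ?_
    rw [tsum_mul_left]
    by_cases hb : K 0 a b = 0
    · simp [hb]
    · have hfin : (List.ofFn fun i => K i.succ).foldr appE (fun _ => 1) b ≠ ∞ := fun htop => by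
        refine h (top_unique ?_)
        have : ‖K 0 a b‖ₑ * (List.ofFn fun i => K i.succ).foldr appE (fun _ => 1) b = ∞ := by
          rw [htop]
          exact ENNReal.mul_top (by simpa using hb)
        rw [← this]
        exact ENNReal.le_tsum (f := fun b => ‖K 0 a b‖ₑ * _) b
      rw [ih _ b hfin (summable_of_tsum_enorm_ne_top (by rwa [tsum_enorm_pathProd]))]

end Path

/-! ### The generating function of the sums `O_h` -/

/-- The arrows that build a pair. -/
def word (p : IndexPair) : List Letter :=
  p.flatMap fun q => Letter.arr q.1 :: List.replicate (q.2 - 1) Letter.up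

/-- The kernel of a column in the generating function of the sums `O_h`. -/
noncomputable def colKer (x : ℝ) (q : ℂ × ℕ) (m n : ℕ) : ℂ :=
  if m < n then q.1 ^ (n - m) * (((((n : ℝ) - x)⁻¹ * ((n : ℝ) ^ (q.2 - 1))⁻¹ : ℝ)) : ℂ) else 0

/-- The kernel of a column, with the exponents `c` not yet summed over. -/
noncomputable def genKer (x : ℝ) (q : ℂ × ℕ) (a b : ℕ × ℕ) : ℂ :=
  if a.1 < b.1 then q.1 ^ (b.1 - a.1) / (b.1 : ℂ) ^ (q.2 + b.2) * (x : ℂ) ^ b.2 else 0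

lemma foldr_app_replicate_up (j : ℕ) (f : ℕ → ℂ) (n : ℕ) :
    ((List.replicate j Letter.up).map (kerL x)).foldr app f n = ((n : ℂ) ^ j)⁻¹ * f n := by
  induction j with
  | zero => simp
  | succ j ih =>
    simp only [List.replicate_succ, List.map_cons, List.foldr_cons]
    rw [app_kerL_up, ih, pow_succ', mul_inv, mul_assoc]

lemma foldr_appE_replicate_up (j : ℕ) (f : ℕ → ℝ≥0∞) (n : ℕ) :
    ((List.replicate j Letter.up).map (kerL x)).foldr appE f n = ‖((n : ℂ) ^ j)⁻¹‖ₑ * f n := by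
  induction j with
  | zero => simp
  | succ j ih =>
    simp only [List.replicate_succ, List.map_cons, List.foldr_cons]
    rw [appE_kerL_up, ih, pow_succ', mul_inv, enorm_mul, mul_assoc]

lemma colKer_eq (q : ℂ × ℕ) (m n : ℕ) :
    colKer x q m n = kerL x (.arr q.1) m n * ((n : ℂ) ^ (q.2 - 1))⁻¹ := by
  by_cases h : m < n
  · simp only [colKer, kerL, if_pos h]
    push_cast
    ring
  · simp [colKer, kerL, h]

lemma foldr_app_word (p : IndexPair) (f : ℕ → ℂ) (n : ℕ) :
    ((word p).map (kerL x)).foldr app f n = (p.map (colKer x)).foldr app f n := by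
  induction p generalizing n with
  | nil => rfl
  | cons q p ih =>
    simp only [word, List.flatMap_cons, List.cons_append, List.map_cons, List.foldr_cons,
      List.map_append, List.foldr_append] at ih ⊢
    refine tsum_congr fun b => ?_
    rw [foldr_app_replicate_up, ih, colKer_eq, mul_assoc]

lemma foldr_appE_word (p : IndexPair) (f : ℕ → ℝ≥0∞) (n : ℕ) :
    ((word p).map (kerL x)).foldr appE f n = (p.map (colKer x)).foldr appE f n := by
  induction p generalizing n with
  | nil => rfl
  | cons q p ih =>
    simp only [word, List.flatMap_cons, List.cons_append, List.map_cons, List.foldr_cons,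
      List.map_append, List.foldr_append] at ih ⊢
    refine tsum_congr fun b => ?_
    rw [foldr_appE_replicate_up, ih, colKer_eq, enorm_mul, mul_assoc]

/-- Geometric series in `x / n`: the exponents `c` of `O_h` are summed out here. -/
lemma hasSum_geometric_div (h0 : 0 ≤ x) (hx : x < 1) {n k : ℕ} (hn : 1 ≤ n) (hk : 1 ≤ k) :
    HasSum (fun c : ℕ => ((n : ℝ) ^ (k + c))⁻¹ * x ^ c)
      (((n : ℝ) - x)⁻¹ * ((n : ℝ) ^ (k - 1))⁻¹) := by
  obtain ⟨k, rfl⟩ := Nat.exists_eq_add_of_le' hk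
  have hn' : (1 : ℝ) ≤ n := by exact_mod_cast hn
  have hn0 : (n : ℝ) ≠ 0 := by positivity
  have hnx : (n : ℝ) - x ≠ 0 := by linarith
  have h := (hasSum_geometric_of_lt_one (r := x / n) (by positivity)
    ((div_lt_one (by positivity)).2 (by linarith))).mul_left ((n : ℝ) ^ (k + 1))⁻¹
  have e : ((n : ℝ) ^ (k + 1))⁻¹ * (1 - x / n)⁻¹ = ((n : ℝ) - x)⁻¹ * ((n : ℝ) ^ (k + 1 - 1))⁻¹ := by
    rw [Nat.add_sub_cancel, one_sub_div hn0, inv_div, pow_succ]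
    field_simp
  rw [e] at h
  refine h.congr_fun fun c => ?_
  rw [div_pow, pow_add _ (k + 1) c]
  field_simp

lemma genKer_eq {q : ℂ × ℕ} (a : ℕ × ℕ) (n c : ℕ) (h : a.1 < n) :
    genKer x q a (n, c)
      = q.1 ^ (n - a.1) * ((((n : ℝ) ^ (q.2 + c))⁻¹ * x ^ c : ℝ) : ℂ) := by
  simp only [genKer, if_pos h]
  push_cast
  ring

lemma tsum_enorm_genKer (h0 : 0 ≤ x) (hx : x < 1) {q : ℂ × ℕ} (hq : 0 < q.2) (a : ℕ × ℕ) (n : ℕ) :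
    ∑' c, ‖genKer x q a (n, c)‖ₑ = ‖colKer x q a.1 n‖ₑ := by
  by_cases h : a.1 < n
  · have hs := hasSum_geometric_div h0 hx (show 1 ≤ n by omega) hq
    have hn := natCast_sub_pos hx (show 1 ≤ n by omega)
    simp only [genKer_eq a n _ h, colKer, if_pos h, enorm_mul, ENNReal.tsum_mul_left]
    rw [enorm_ofReal_of_nonneg (by positivity), ← hs.tsum_eq,
      ENNReal.ofReal_tsum_of_nonneg (fun c => by positivity) hs.summable]
    congr 1
    exact tsum_congr fun c => enorm_ofReal_of_nonneg (by positivity)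
  · simp [genKer, colKer, h]

lemma hasSum_genKer (h0 : 0 ≤ x) (hx : x < 1) {q : ℂ × ℕ} (hq : 0 < q.2) (a : ℕ × ℕ) (n : ℕ) :
    HasSum (fun c => genKer x q a (n, c)) (colKer x q a.1 n) := by
  by_cases h : a.1 < n
  · have hs := hasSum_geometric_div h0 hx (show 1 ≤ n by omega) hq
    simp only [genKer_eq a n _ h, colKer, if_pos h]
    exact ((Complex.hasSum_ofReal).2 hs).mul_left _
  · simp [genKer, colKer, h]

/-- A state is a pair of chain entry and exponent, so chains and exponents form a single path sum.
The kernel ignores the exponent of the previous state, hence the exponents are summed out column by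
column. -/
lemma foldr_appE_genKer (h0 : 0 ≤ x) (hx : x < 1) (p : IndexPair) (hp : ∀ q ∈ p, 0 < q.2)
    (a : ℕ × ℕ) : (p.map (genKer x)).foldr appE (fun _ => 1) a
      = (p.map (colKer x)).foldr appE (fun _ => 1) a.1 := by
  induction p generalizing a with
  | nil => rfl
  | cons q p ih =>
    simp only [List.map_cons, List.foldr_cons]
    rw [appE, ENNReal.tsum_prod']
    refine tsum_congr fun n => ?_
    simp only [ih fun q' h => hp q' (List.mem_cons_of_mem _ h), ENNReal.tsum_mul_right]
    rw [tsum_enorm_genKer h0 hx (hp q List.mem_cons_self)]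

lemma foldr_app_genKer (h0 : 0 ≤ x) (hx : x < 1) (p : IndexPair) (hp : ∀ q ∈ p, 0 < q.2)
    (a : ℕ × ℕ) (hfin : (p.map (colKer x)).foldr appE (fun _ => 1) a.1 ≠ ∞) :
    (p.map (genKer x)).foldr app (fun _ => 1) a
      = (p.map (colKer x)).foldr app (fun _ => 1) a.1 := by
  induction p generalizing a with
  | nil => rfl
  | cons q p ih =>
    have hp' : ∀ q' ∈ p, 0 < q'.2 := fun q' h => hp q' (List.mem_cons_of_mem _ h)
    have hq := hp q List.mem_cons_self
    have hs : Summable fun b : ℕ × ℕ =>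
        genKer x q a b * (p.map (genKer x)).foldr app (fun _ => 1) b := by
      refine summable_of_tsum_enorm_ne_top (ne_top_of_le_ne_top hfin ?_)
      rw [← foldr_appE_genKer h0 hx _ hp]
      refine ENNReal.tsum_le_tsum fun b => ?_
      rw [enorm_mul]
      exact mul_le_mul' le_rfl ((enorm_foldr_app_le _ _ _).trans (by simp))
    simp only [List.map_cons, List.foldr_cons] at hfin ⊢
    rw [app, hs.tsum_prod]
    refine tsum_congr fun n => ?_
    by_cases hb : colKer x q a.1 n = 0
    · have hz : ∀ c, genKer x q a (n, c) = 0 := by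
        have := tsum_enorm_genKer h0 hx hq a n
        rw [hb, enorm_zero, ENNReal.tsum_eq_zero] at this
        exact fun c => by simpa using this c
      simp [hz, hb]
    · have hfin' : (p.map (colKer x)).foldr appE (fun _ => 1) n ≠ ∞ := fun htop => by
        refine hfin (top_unique ?_)
        have : ‖colKer x q a.1 n‖ₑ * (p.map (colKer x)).foldr appE (fun _ => 1) n = ∞ := by
          rw [htop]
          exact ENNReal.mul_top (by simpa using hb)
        rw [← this]
        exact ENNReal.le_tsum (f := fun b => ‖colKer x q a.1 b‖ₑ * _) n
      simp only [fun c => ih hp' (n, c) hfin', tsum_mul_right]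
      rw [(hasSum_genKer h0 hx hq a n).tsum_eq]

/-! ### Chains as the paths with nonzero product -/

lemma strictMono_cons_iff {r : ℕ} (s : Fin r → ℕ) :
    StrictMono (Fin.cons 0 s : Fin (r + 1) → ℕ)
      ↔ ∀ i : Fin r, (Fin.cons 0 s : Fin (r + 1) → ℕ) i.castSucc < s i := by
  simp [Fin.strictMono_iff_lt_succ]

/-- The positive part of a chain. -/
def Chain.tail {r : ℕ} (m : Chain r) : Fin r → ℕ := fun i => m.1 i.succ

lemma Chain.cons_tail {r : ℕ} (m : Chain r) : (Fin.cons 0 m.tail : Fin (r + 1) → ℕ) = m.1 := by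
  refine funext (Fin.cases ?_ fun i => ?_)
  · exact m.2.1.symm
  · rfl

lemma Chain.tail_injective {r : ℕ} : Function.Injective (Chain.tail (r := r)) := fun m m' h =>
  Subtype.ext (by rw [← m.cons_tail, ← m'.cons_tail, h])

lemma pathProd_genKer_tail {r : ℕ} (q : Fin r → ℂ × ℕ) (c : Fin r → ℕ) (m : Chain r) :
    pathProd (fun i => genKer x (q i)) (0, 0) (fun i => (m.tail i, c i))
      = (x : ℂ) ^ (∑ i, c i) * liTerm (fun i => (q i).1) (fun i => (q i).2 + c i) m := by
  have e : ∀ i : Fin r, ((Fin.cons (0, 0) (fun i => (m.tail i, c i)) : Fin (r + 1) → ℕ × ℕ)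
      i.castSucc).1 = m.1 i.castSucc := fun i => by
    rw [← m.cons_tail]
    refine Fin.cases ?_ (fun j => ?_) i.castSucc <;> simp
  rw [pathProd, liTerm, ← prod_pow_eq_pow_sum, ← prod_mul_distrib]
  refine prod_congr rfl fun i _ => ?_
  have h : m.1 i.castSucc < m.tail i := m.2.2 i.castSucc_lt_succ
  rw [genKer, e, if_pos h, mul_comm]
  rfl

lemma pathProd_genKer_eq_zero {r : ℕ} (q : Fin r → ℂ × ℕ) (c s : Fin r → ℕ)
    (hs : s ∉ Set.range (Chain.tail (r := r))) :
    pathProd (fun i => genKer x (q i)) (0, 0) (fun i => (s i, c i)) = 0 := by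
  have h : ¬ ∀ i : Fin r, (Fin.cons 0 s : Fin (r + 1) → ℕ) i.castSucc < s i := fun h =>
    hs ⟨⟨Fin.cons 0 s, by simp, (strictMono_cons_iff s).2 h⟩, by ext i; simp [Chain.tail]⟩
  push Not at h
  obtain ⟨i, hi⟩ := h
  have e : ((Fin.cons (0, 0) (fun i => (s i, c i)) : Fin (r + 1) → ℕ × ℕ)
      i.castSucc).1 = (Fin.cons 0 s : Fin (r + 1) → ℕ) i.castSucc := by
    refine Fin.cases ?_ (fun j => ?_) i.castSucc <;> simp
  refine prod_eq_zero (mem_univ i) ?_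
  refine if_neg ?_
  rw [e]
  exact not_lt.2 hi

/-- The sums `O_h` converge and have the expected generating function. -/
theorem hasSum_ohnoSum (h0 : 0 < x) (hx : x < 1) (p : IndexPair) (hp : ∀ q ∈ p, 0 < q.2)
    (hfin : (p.map (colKer x)).foldr appE (fun _ => 1) 0 ≠ ∞) :
    (∀ h, OhnoConverges h p) ∧
    HasSum (fun h => (x : ℂ) ^ h * ohnoSum h p) ((p.map (colKer x)).foldr app (fun _ => 1) 0) ∧
    ∑' h, ‖(x : ℂ) ^ h * ohnoSum h p‖ₑ ≤ (p.map (colKer x)).foldr appE (fun _ => 1) 0 := by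
  set r := p.length
  set K : Fin r → ℕ × ℕ → ℕ × ℕ → ℂ := fun i => genKer x (p.get i)
  set L : (Fin r → ℕ) → ℂ := fun c => liSh (fun i => (p.get i).1) (fun i => (p.get i).2 + c i)
  set T : (Fin r → ℕ) × (Fin r → ℕ) → ℂ := fun t => pathProd K (0, 0) fun i => (t.2 i, t.1 i)
  have hx0 : ∀ j : ℕ, (x : ℂ) ^ j ≠ 0 := fun j =>
    pow_ne_zero _ (by exact_mod_cast h0.ne')
  have hKl : List.ofFn K = p.map (genKer x) := by
    conv_rhs => rw [← List.ofFn_get p, List.map_ofFn]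
    rfl
  -- A path of pairs is the same as a pair of tuples: exponents first, chain entries second.
  let e : (Fin r → ℕ) × (Fin r → ℕ) ≃ (Fin r → ℕ × ℕ) :=
    (Equiv.prodComm _ _).trans (Equiv.arrowProdEquivProdArrow _ _ _).symm
  have hE : ∑' t, ‖T t‖ₑ = (p.map (colKer x)).foldr appE (fun _ => 1) 0 := by
    rw [← foldr_appE_genKer h0.le hx p hp (0, 0), ← hKl, ← tsum_enorm_pathProd, ← e.tsum_eq]
    rfl
  have hsT : Summable T := summable_of_tsum_enorm_ne_top (by rwa [hE])
  have hsumT : HasSum T ((p.map (colKer x)).foldr app (fun _ => 1) 0) := by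
    rw [← foldr_app_genKer h0.le hx p hp (0, 0) hfin, ← hKl]
    refine (e.hasSum_iff (f := pathProd K (0, 0))).2 (hasSum_pathProd K (0, 0) ?_)
    rwa [hKl, foldr_appE_genKer h0.le hx p hp]
  have htail : ∀ c (m : Chain r), T (c, m.tail)
      = (x : ℂ) ^ (∑ i, c i) * liTerm (fun i => (p.get i).1) (fun i => (p.get i).2 + c i) m :=
    fun c m => pathProd_genKer_tail (fun i => p.get i) c m
  have hc : ∀ c, ∑' s, T (c, s) = (x : ℂ) ^ (∑ i, c i) * L c := fun c => by
    change _ = (x : ℂ) ^ (∑ i, c i) * ∑' m, liTerm _ _ m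
    rw [← tsum_mul_left, ← Chain.tail_injective.tsum_eq]
    · exact tsum_congr fun m => htail c m
    · intro s hs
      by_contra hn
      exact hs (pathProd_genKer_eq_zero (fun i => p.get i) c s hn)
  have hsumc : HasSum (fun c => (x : ℂ) ^ (∑ i, c i) * L c)
      ((p.map (colKer x)).foldr app (fun _ => 1) 0) := by
    simp only [← hc]
    exact hsumT.prod_fiberwise fun c => (hsT.prod_factor c).hasSum
  have hohno : ∀ h, ∑ c : Nat.antidiagonalTuple r h, (x : ℂ) ^ (∑ i, c.1 i) * L c.1
      = (x : ℂ) ^ h * ohnoSum h p := fun h => by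
    rw [sum_coe_sort (Nat.antidiagonalTuple r h) fun c => (x : ℂ) ^ (∑ i, c i) * L c,
      ohnoSum, mul_sum]
    refine sum_congr rfl fun c hc => ?_
    rw [(Nat.mem_antidiagonalTuple).1 hc]
  let e' := Nat.sigmaAntidiagonalTupleEquivTuple r
  refine ⟨fun h c _ => ?_, ?_, ?_⟩
  -- For fixed exponents the family restricts to chains, and the factor `x ^ (∑ i, c i)` is nonzero
  -- because `x > 0`.
  · have h1 := (hsT.prod_factor c).comp_injective Chain.tail_injective
    have h2 : Summable fun m : Chain r => (x : ℂ) ^ (∑ i, c i) *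
        liTerm (fun i => (p.get i).1) (fun i => (p.get i).2 + c i) m :=
      h1.congr fun m => htail c m
    exact ((summable_mul_left_iff (hx0 _)).1 h2).norm
  · have h1 := (e'.hasSum_iff).2 hsumc
    refine h1.sigma fun h => ?_
    rw [← hohno h]
    exact hasSum_fintype _
  · calc ∑' h, ‖(x : ℂ) ^ h * ohnoSum h p‖ₑ
        ≤ ∑' h, ∑' c : Nat.antidiagonalTuple r h, ‖(x : ℂ) ^ (∑ i, c.1 i) * L c.1‖ₑ := by
          refine ENNReal.tsum_le_tsum fun h => ?_
          rw [← hohno h, tsum_fintype]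
          exact enorm_sum_le _ _
      _ = ∑' c, ‖(x : ℂ) ^ (∑ i, c i) * L c‖ₑ := by
          rw [← e'.tsum_eq, ENNReal.tsum_sigma']
          rfl
      _ ≤ ∑' c, ∑' s, ‖T (c, s)‖ₑ := by
          refine ENNReal.tsum_le_tsum fun c => ?_
          rw [← hc]
          exact enorm_tsum_le_tsum_enorm
      _ = _ := (ENNReal.tsum_prod' (f := fun t => ‖T t‖ₑ)).symm.trans hE

/-! ### Insertion of columns -/

/-- The sum of `∏ 1 / (mᵢ - x)` over `m < m₁ < ⋯ < m_b < n`, divided by `n - x`. -/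
noncomputable def tau (x : ℝ) : ℕ → ℕ → ℕ → ℝ
  | 0, _, n => ((n : ℝ) - x)⁻¹
  | b + 1, m, n => ∑ j ∈ Ioo m n, ((j : ℝ) - x)⁻¹ * tau x b j n

/-- The kernel of `b` columns `(w, 1)` followed by `→w`. -/
noncomputable def insKer (x : ℝ) (w : ℂ) (b m n : ℕ) : ℂ :=
  if m < n then w ^ (n - m) * (tau x b m n : ℂ) else 0

/-- The kernel of a column in the generating function of the sums `O_h` with insertions. -/
noncomputable def colKerR (x : ℝ) (q : ℂ × ℕ) (m n : ℕ) : ℂ :=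
  kerR x (.arr q.1) m n * ((n : ℂ) ^ (q.2 - 1))⁻¹

lemma foldr_app_kerR_word (p : IndexPair) (f : ℕ → ℂ) (n : ℕ) :
    ((word p).map (kerR x)).foldr app f n = (p.map (colKerR x)).foldr app f n := by
  induction p generalizing n with
  | nil => rfl
  | cons q p ih =>
    simp only [word, List.flatMap_cons, List.cons_append, List.map_cons, List.foldr_cons,
      List.map_append, List.foldr_append] at ih ⊢
    refine tsum_congr fun b => ?_
    have e : (List.replicate (q.2 - 1) Letter.up).map (kerR x)
        = (List.replicate (q.2 - 1) Letter.up).map (kerL x) := by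
      rw [List.map_replicate, List.map_replicate]
      rfl
    rw [e, foldr_app_replicate_up, ih, colKerR, mul_assoc]

lemma foldr_appE_kerR_word (p : IndexPair) (f : ℕ → ℝ≥0∞) (n : ℕ) :
    ((word p).map (kerR x)).foldr appE f n = (p.map (colKerR x)).foldr appE f n := by
  induction p generalizing n with
  | nil => rfl
  | cons q p ih =>
    simp only [word, List.flatMap_cons, List.cons_append, List.map_cons, List.foldr_cons,
      List.map_append, List.foldr_append] at ih ⊢
    refine tsum_congr fun b => ?_
    have e : (List.replicate (q.2 - 1) Letter.up).map (kerR x)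
        = (List.replicate (q.2 - 1) Letter.up).map (kerL x) := by
      rw [List.map_replicate, List.map_replicate]
      rfl
    rw [e, foldr_appE_replicate_up, ih, colKerR, enorm_mul, mul_assoc]

lemma tau_nonneg (hx : x < 1) (b m n : ℕ) (h : m < n) : 0 ≤ tau x b m n := by
  induction b generalizing m with
  | zero => exact inv_nonneg.2 (natCast_sub_pos hx (by omega)).le
  | succ b ih =>
    refine sum_nonneg fun j hj => ?_
    rw [mem_Ioo] at hj
    exact mul_nonneg (inv_nonneg.2 (natCast_sub_pos hx (by omega)).le) (ih j hj.2)

/-- Telescoping: `x / (j - x)` times `poch x j / j!` is the drop of `poch x i / i!` from `i = j - 1`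
to `i = j`. -/
lemma ratio_eq_add_sum (hx : x < 1) {m n : ℕ} (h : m < n) :
    ratio x m n = ((n : ℝ) - x)⁻¹ + ∑ j ∈ Ioo m n, x * (((j : ℝ) - x)⁻¹ * ratio x j n) := by
  obtain ⟨k, rfl⟩ := Nat.exists_eq_add_of_le (show m + 1 ≤ n by omega)
  set s : ℝ := (m + k).factorial / poch x (m + k + 1) with hs
  have hr : ∀ j, ratio x j (m + 1 + k) = poch x j / j.factorial * s := fun j => by
    rw [ratio, show m + 1 + k = m + k + 1 by ring, Nat.add_sub_cancel]
  have hI : Ioo m (m + 1 + k) = Ico (m + 1) (m + k + 1) := by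
    ext j
    simp only [mem_Ioo, mem_Ico]
    omega
  have hstep : ∀ j, x * ((((j + 1 : ℕ) : ℝ) - x)⁻¹ * (poch x (j + 1) / (j + 1).factorial * s))
      = poch x j / j.factorial * s - poch x (j + 1) / (j + 1).factorial * s := fun j => by
    have h2 := (natCast_sub_pos hx (Nat.succ_pos j)).ne'
    have h3 : (j.factorial : ℝ) ≠ 0 := by exact_mod_cast j.factorial_pos.ne'
    rw [poch_succ, Nat.factorial_succ]
    push_cast at h2 ⊢
    field_simp
    ring
  have hsum : ∑ j ∈ Ico (m + 1) (m + k + 1),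
      x * (((j : ℝ) - x)⁻¹ * (poch x j / j.factorial * s))
      = poch x m / m.factorial * s - poch x (m + k) / (m + k).factorial * s := by
    rw [sum_Ico_eq_sum_range, show m + k + 1 - (m + 1) = k by omega]
    have hsub := Finset.sum_range_sub' (fun i => poch x (m + i) / (m + i).factorial * s) k
    rw [add_zero] at hsub
    rw [← hsub]
    refine sum_congr rfl fun i _ => ?_
    rw [show m + 1 + i = m + i + 1 by ring, hstep, ← add_assoc]
  simp only [hr, hI]
  rw [hsum, hs, poch_div_mul_eq_inv hx, show m + 1 + k = m + k + 1 by ring]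
  ring

/-- This is the expansion of `∏ (1 + x / (i - x))` by the number of chosen factors, obtained by
recursion on the smallest chosen index. -/
lemma hasSum_tau (hx : x < 1) (m n : ℕ) (h : m < n) :
    HasSum (fun b => x ^ b * tau x b m n) (ratio x m n) := by
  induction hk : n - m using Nat.strong_induction_on generalizing m with
  | _ k ih =>
    have h1 : HasSum (fun b => x ^ (b + 1) * tau x (b + 1) m n)
        (∑ j ∈ Ioo m n, x * (((j : ℝ) - x)⁻¹ * ratio x j n)) := by
      have := hasSum_sum (s := Ioo m n)
        (f := fun (j b : ℕ) => x * (((j : ℝ) - x)⁻¹ * (x ^ b * tau x b j n)))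
        (a := fun j : ℕ => x * (((j : ℝ) - x)⁻¹ * ratio x j n)) fun j hj => by
          rw [mem_Ioo] at hj
          exact ((ih (n - j) (by omega) j hj.2 rfl).mul_left _).mul_left _
      refine this.congr_fun fun b => ?_
      rw [tau, mul_sum]
      exact sum_congr rfl fun j _ => by ring
    rw [ratio_eq_add_sum hx h]
    have := h1.zero_add (f := fun b => x ^ b * tau x b m n)
    simpa [tau] using this

lemma enorm_insKer (hx : x < 1) (w : ℂ) (b : ℕ) {m n : ℕ} (h : m < n) :
    ‖insKer x w b m n‖ₑ = ‖w ^ (n - m)‖ₑ * ENNReal.ofReal (tau x b m n) := by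
  rw [insKer, if_pos h, enorm_mul, enorm_ofReal_of_nonneg (tau_nonneg hx b m n h)]

lemma hasSum_insKer (hx : x < 1) {w : ℂ} (hw : w ≠ 1) (m n : ℕ) :
    HasSum (fun b => (x : ℂ) ^ b * insKer x w b m n) (kerR x (.arr w) m n) := by
  by_cases h : m < n
  · simp only [insKer, kerR, if_pos h, weightR, if_neg hw]
    refine ((Complex.hasSum_ofReal.2 (hasSum_tau hx m n h)).mul_left (w ^ (n - m))).congr_fun
      fun b => ?_
    push_cast
    ring
  · simp [insKer, kerR, h]

lemma tsum_enorm_insKer (h0 : 0 ≤ x) (hx : x < 1) {w : ℂ} (hw : w ≠ 1) (m n : ℕ) :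
    ∑' b, ‖(x : ℂ) ^ b‖ₑ * ‖insKer x w b m n‖ₑ = ‖kerR x (.arr w) m n‖ₑ := by
  by_cases h : m < n
  · have hs := hasSum_tau hx m n h
    simp only [enorm_insKer hx w _ h, kerR, if_pos h, weightR, if_neg hw, enorm_mul]
    rw [enorm_ofReal_of_nonneg (ratio_pos hx m n).le, ← hs.tsum_eq,
      ENNReal.ofReal_tsum_of_nonneg (fun b => mul_nonneg (pow_nonneg h0 b) (tau_nonneg hx b m n h))
        hs.summable, ← ENNReal.tsum_mul_left]
    refine tsum_congr fun b => ?_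
    rw [ENNReal.ofReal_mul (pow_nonneg h0 b), ← Complex.ofReal_pow,
      enorm_ofReal_of_nonneg (pow_nonneg h0 b)]
    ring
  · simp [insKer, kerR, h]

/-- All inserted columns carry the same `w`, so the powers combine to `w ^ (n - m)` whatever the
intermediate index; only a finite sum of weights remains. -/
lemma tsum_kerL_mul_insKer (w : ℂ) (b m n : ℕ) :
    ∑' j, kerL x (.arr w) m j * insKer x w b j n = insKer x w (b + 1) m n := by
  have hz : ∀ j ∉ Ioo m n, kerL x (.arr w) m j * insKer x w b j n = 0 := fun j hj => by
    rw [mem_Ioo, not_and_or] at hj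
    rcases hj with hj | hj <;> simp [kerL, insKer, hj]
  rw [tsum_eq_sum hz]
  by_cases h : m < n
  · rw [insKer, if_pos h, tau, Complex.ofReal_sum, mul_sum]
    refine sum_congr rfl fun j hj => ?_
    rw [mem_Ioo] at hj
    rw [kerL, insKer, if_pos hj.1, if_pos hj.2, show n - m = (j - m) + (n - j) by omega, pow_add]
    push_cast
    ring
  · rw [insKer, if_neg h, Ioo_eq_empty (by omega), sum_empty]

lemma tsum_enorm_kerL_mul_insKer (hx : x < 1) (w : ℂ) (b m n : ℕ) :
    ∑' j, ‖kerL x (.arr w) m j‖ₑ * ‖insKer x w b j n‖ₑ = ‖insKer x w (b + 1) m n‖ₑ := by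
  have hz : ∀ j ∉ Ioo m n, ‖kerL x (.arr w) m j‖ₑ * ‖insKer x w b j n‖ₑ = 0 := fun j hj => by
    rw [mem_Ioo, not_and_or] at hj
    rcases hj with hj | hj <;> simp [kerL, insKer, hj]
  rw [tsum_eq_sum hz]
  by_cases h : m < n
  · have hnn : ∀ j ∈ Ioo m n, 0 ≤ ((j : ℝ) - x)⁻¹ := fun j hj => by
      rw [mem_Ioo] at hj
      exact inv_nonneg.2 (natCast_sub_pos hx (by omega)).le
    rw [enorm_insKer hx w _ h, tau, ENNReal.ofReal_sum_of_nonneg fun j hj =>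
      mul_nonneg (hnn j hj) (tau_nonneg hx b j n (mem_Ioo.1 hj).2), mul_sum]
    refine sum_congr rfl fun j hj => ?_
    have hj' := mem_Ioo.1 hj
    rw [enorm_insKer hx w _ hj'.2, ENNReal.ofReal_mul (hnn j hj), kerL, if_pos hj'.1, enorm_mul,
      enorm_ofReal_of_nonneg (hnn j hj), show n - m = (j - m) + (n - j) by omega, pow_add,
      enorm_mul]
    ring
  · rw [insKer, if_neg h, Ioo_eq_empty (by omega), sum_empty, enorm_zero]

lemma foldr_appE_replicate_kerL (hx : x < 1) (w : ℂ) (b : ℕ) (g : ℕ → ℝ≥0∞) (m : ℕ) :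
    (List.replicate b (kerL x (.arr w))).foldr appE (appE (kerL x (.arr w)) g) m
      = appE (insKer x w b) g m := by
  induction b generalizing m with
  | zero => rfl
  | succ b ih =>
    simp only [List.replicate_succ, List.foldr_cons]
    rw [funext ih]
    simp only [appE, ← ENNReal.tsum_mul_left]
    rw [ENNReal.tsum_comm]
    refine tsum_congr fun n => ?_
    simp only [← mul_assoc, ENNReal.tsum_mul_right]
    rw [tsum_enorm_kerL_mul_insKer hx]

lemma foldr_app_replicate_kerL (hx : x < 1) (w : ℂ) (b : ℕ) (g : ℕ → ℂ) (m : ℕ)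
    (h : appE (insKer x w b) (fun n => ‖g n‖ₑ) m ≠ ∞) :
    (List.replicate b (kerL x (.arr w))).foldr app (app (kerL x (.arr w)) g) m
      = app (insKer x w b) g m := by
  induction b generalizing m with
  | zero => rfl
  | succ b ih =>
    rw [← foldr_appE_replicate_kerL hx] at h
    simp only [List.replicate_succ, List.foldr_cons] at h ⊢
    rw [funext (foldr_appE_replicate_kerL hx w b _)] at h
    have e : app (kerL x (.arr w)) ((List.replicate b (kerL x (.arr w))).foldr app
        (app (kerL x (.arr w)) g)) m = app (kerL x (.arr w)) (app (insKer x w b) g) m := by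
      refine tsum_congr fun j => ?_
      by_cases hj : kerL x (.arr w) m j = 0
      · simp [hj]
      · rw [ih j]
        intro htop
        refine h (top_unique ?_)
        have : ‖kerL x (.arr w) m j‖ₑ * appE (insKer x w b) (fun n => ‖g n‖ₑ) j = ∞ := by
          rw [htop]
          exact ENNReal.mul_top (by simpa using hj)
        rw [← this]
        exact ENNReal.le_tsum (f := fun j => ‖kerL x (.arr w) m j‖ₑ * _) j
    rw [e]
    have hs : Summable fun p : ℕ × ℕ => kerL x (.arr w) m p.1 * (insKer x w b p.1 p.2 * g p.2) := by
      refine summable_of_tsum_enorm_ne_top ?_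
      rw [ENNReal.tsum_prod (f := fun j n => ‖kerL x (.arr w) m j * (insKer x w b j n * g n)‖ₑ)]
      simpa [appE, enorm_mul, ENNReal.tsum_mul_left] using h
    simp only [app, ← tsum_mul_left]
    rw [← Summable.tsum_comm
      (f := fun j n => kerL x (.arr w) m j * (insKer x w b j n * g n)) hs]
    refine tsum_congr fun n => ?_
    simp only [← mul_assoc, tsum_mul_right]
    rw [tsum_kerL_mul_insKer]

/-! ### Insertions into a whole pair -/

lemma colKer_one (w : ℂ) : colKer x (w, 1) = kerL x (.arr w) := by
  ext m n
  simp [colKer_eq]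

lemma foldr_appE_insert (hx : x < 1) (w : ℂ) (l b : ℕ) (p : IndexPair) (m : ℕ) :
    ((List.replicate b (w, 1) ++ (w, l) :: p).map (colKer x)).foldr appE (fun _ => 1) m
      = appE (insKer x w b) (fun n => ‖((n : ℂ) ^ (l - 1))⁻¹‖ₑ *
        (p.map (colKer x)).foldr appE (fun _ => 1) n) m := by
  rw [List.map_append, List.map_replicate, List.map_cons, List.foldr_append, List.foldr_cons,
    colKer_one, ← foldr_appE_replicate_kerL hx]
  refine congrArg (fun g => List.foldr appE g _ m) (funext fun j => tsum_congr fun n => ?_)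
  rw [colKer_eq, enorm_mul, mul_assoc]

lemma foldr_app_insert (hx : x < 1) (w : ℂ) (l b : ℕ) (p : IndexPair) (m : ℕ)
    (h : ((List.replicate b (w, 1) ++ (w, l) :: p).map (colKer x)).foldr appE (fun _ => 1) m ≠ ∞) :
    ((List.replicate b (w, 1) ++ (w, l) :: p).map (colKer x)).foldr app (fun _ => 1) m
      = app (insKer x w b) (fun n => ((n : ℂ) ^ (l - 1))⁻¹ *
        (p.map (colKer x)).foldr app (fun _ => 1) n) m := by
  rw [foldr_appE_insert hx] at h
  rw [List.map_append, List.map_replicate, List.map_cons, List.foldr_append, List.foldr_cons,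
    colKer_one, ← foldr_app_replicate_kerL hx]
  · refine congrArg (fun g => List.foldr app g _ m) (funext fun j => tsum_congr fun n => ?_)
    rw [colKer_eq, mul_assoc]
  · refine ne_top_of_le_ne_top h (appE_mono_right _ (fun n => ?_) m)
    rw [enorm_mul]
    exact mul_le_mul' le_rfl ((enorm_foldr_app_le _ _ _).trans (by simp))

open Classical in
/-- The number of columns `(z, k)` with `z ≠ 1`. -/
noncomputable def numNeOne : IndexPair → ℕ
  | [] => 0
  | q :: p => if q.1 = 1 then numNeOne p else numNeOne p + 1

lemma insertOnes_one (l : ℕ) (p : IndexPair) (bs : List ℕ) :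
    insertOnes ((1, l) :: p) bs = (1, l) :: insertOnes p bs := by
  simp [insertOnes]

lemma insertOnes_ne_one {w : ℂ} (hw : w ≠ 1) (l : ℕ) (p : IndexPair) {d : ℕ} (b : ℕ)
    (c : Fin d → ℕ) :
    insertOnes ((w, l) :: p) (List.ofFn (Fin.cons b c : Fin (d + 1) → ℕ))
      = List.replicate b (w, 1) ++ (w, l) :: insertOnes p (List.ofFn c) := by
  rw [insertOnes, if_neg hw]
  simp

lemma colKerR_one (l : ℕ) : colKerR x (1, l) = colKer x (1, l) := by
  ext m n
  simp [colKer_eq, colKerR, kerR, kerL, weightR]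

/-- In `ℝ≥0∞` all sums commute and the positive weights lose nothing, so this is an equality. It
supplies both the finiteness for each single `b` and the summability over `b` of the complex series.
-/
lemma tsum_enorm_insertOnes (h0 : 0 ≤ x) (hx : x < 1) (q : IndexPair) (d : ℕ)
    (hd : numNeOne q = d) (m : ℕ) :
    ∑' b : Fin d → ℕ, ‖(x : ℂ) ^ (∑ i, b i)‖ₑ *
        ((insertOnes q (List.ofFn b)).map (colKer x)).foldr appE (fun _ => 1) m
      = (q.map (colKerR x)).foldr appE (fun _ => 1) m := by
  induction q generalizing d m with
  | nil =>
    obtain rfl : d = 0 := hd.symm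
    rw [tsum_fintype]
    simp [insertOnes]
  | cons col q ih =>
    obtain ⟨w, l⟩ := col
    by_cases hw : w = 1
    · subst hw
      simp only [numNeOne, if_true] at hd
      simp only [insertOnes_one, List.map_cons, List.foldr_cons, colKerR_one]
      simp only [appE, ← ENNReal.tsum_mul_left]
      rw [ENNReal.tsum_comm]
      refine tsum_congr fun n => ?_
      rw [← ih d hd, ← ENNReal.tsum_mul_left]
      exact tsum_congr fun b => by ring
    · simp only [numNeOne, if_neg hw] at hd
      obtain _ | d := d
      · omega
      rw [← (Fin.consEquiv fun _ : Fin (d + 1) => ℕ).tsum_eq, ENNReal.tsum_prod']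
      simp only [consEquiv_apply', insertOnes_ne_one hw, foldr_appE_insert hx, Fin.sum_univ_succ,
        Fin.cons_zero, Fin.cons_succ, List.map_cons, List.foldr_cons, pow_add, enorm_mul]
      calc _ = ∑' b₀ : ℕ, ∑' c : Fin d → ℕ, ∑' n,
            ‖(x : ℂ) ^ b₀‖ₑ * ‖insKer x w b₀ m n‖ₑ * (‖((n : ℂ) ^ (l - 1))⁻¹‖ₑ *
              (‖(x : ℂ) ^ (∑ i, c i)‖ₑ *
              ((insertOnes q (List.ofFn c)).map (colKer x)).foldr appE (fun _ => 1) n)) := by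
            refine tsum_congr fun b₀ => tsum_congr fun c => ?_
            rw [appE, ← ENNReal.tsum_mul_left]
            exact tsum_congr fun n => by ring
        _ = ∑' n, ∑' b₀ : ℕ, ∑' c : Fin d → ℕ,
            ‖(x : ℂ) ^ b₀‖ₑ * ‖insKer x w b₀ m n‖ₑ * (‖((n : ℂ) ^ (l - 1))⁻¹‖ₑ *
              (‖(x : ℂ) ^ (∑ i, c i)‖ₑ *
              ((insertOnes q (List.ofFn c)).map (colKer x)).foldr appE (fun _ => 1) n)) := by
            symm
            rw [ENNReal.tsum_comm]
            exact tsum_congr fun b₀ => ENNReal.tsum_comm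
        _ = _ := by
            refine tsum_congr fun n => ?_
            simp only [ENNReal.tsum_mul_left, ENNReal.tsum_mul_right]
            rw [tsum_enorm_insKer h0 hx hw, ih d (by omega) n, colKerR, enorm_mul, mul_assoc]

/-- The computation of `tsum_enorm_insertOnes` repeated without absolute values, each exchange being
licensed by that equality. -/
lemma hasSum_insertOnes (h0 : 0 < x) (hx : x < 1) (q : IndexPair) (d : ℕ)
    (hd : numNeOne q = d) (m : ℕ) (hfin : (q.map (colKerR x)).foldr appE (fun _ => 1) m ≠ ∞) :
    HasSum (fun b : Fin d → ℕ => (x : ℂ) ^ (∑ i, b i) *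
        ((insertOnes q (List.ofFn b)).map (colKer x)).foldr app (fun _ => 1) m)
      ((q.map (colKerR x)).foldr app (fun _ => 1) m) := by
  have hle : ∀ (q : IndexPair) (d : ℕ) (b : Fin d → ℕ) (m : ℕ), ‖(x : ℂ) ^ (∑ i, b i) *
      ((insertOnes q (List.ofFn b)).map (colKer x)).foldr app (fun _ => 1) m‖ₑ
      ≤ ‖(x : ℂ) ^ (∑ i, b i)‖ₑ *
        ((insertOnes q (List.ofFn b)).map (colKer x)).foldr appE (fun _ => 1) m :=
    fun q d b m => by
      rw [enorm_mul]
      exact mul_le_mul' le_rfl ((enorm_foldr_app_le _ _ _).trans (by simp))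
  have hsum : ∀ (q : IndexPair) (d : ℕ) (_ : numNeOne q = d) (m : ℕ)
      (_ : (q.map (colKerR x)).foldr appE (fun _ => 1) m ≠ ∞),
      Summable (fun b : Fin d → ℕ => (x : ℂ) ^ (∑ i, b i) *
        ((insertOnes q (List.ofFn b)).map (colKer x)).foldr app (fun _ => 1) m) :=
    fun q d hd m hfin => by
      refine summable_of_tsum_enorm_ne_top (ne_top_of_le_ne_top hfin ?_)
      rw [← tsum_enorm_insertOnes h0.le hx q d hd m]
      exact ENNReal.tsum_le_tsum fun b => hle q d b m
  refine (hsum q d hd m hfin).hasSum_iff.2 ?_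
  induction q generalizing d m with
  | nil =>
    obtain rfl : d = 0 := hd.symm
    rw [tsum_fintype]
    simp [insertOnes]
  | cons col q ih =>
    obtain ⟨w, l⟩ := col
    have hq : ∀ n, colKerR x (w, l) m n ≠ 0 →
        (q.map (colKerR x)).foldr appE (fun _ => 1) n ≠ ∞ := fun n hn htop => by
      refine hfin (top_unique ?_)
      have : ‖colKerR x (w, l) m n‖ₑ * (q.map (colKerR x)).foldr appE (fun _ => 1) n = ∞ := by
        rw [htop]
        exact ENNReal.mul_top (by simpa using hn)
      rw [← this]
      exact ENNReal.le_tsum (f := fun n => ‖colKerR x (w, l) m n‖ₑ * _) n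
    by_cases hw : w = 1
    · subst hw
      simp only [numNeOne, if_true] at hd
      simp only [insertOnes_one, List.map_cons, List.foldr_cons, colKerR_one] at hq hfin ⊢
      have hs : Summable fun p : (Fin d → ℕ) × ℕ => (x : ℂ) ^ (∑ i, p.1 i) *
          (colKer x (1, l) m p.2 *
          ((insertOnes q (List.ofFn p.1)).map (colKer x)).foldr app (fun _ => 1) p.2) := by
        refine summable_of_tsum_enorm_ne_top (ne_top_of_le_ne_top hfin ?_)
        rw [ENNReal.tsum_prod', ENNReal.tsum_comm]
        refine ENNReal.tsum_le_tsum fun n => ?_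
        rw [← tsum_enorm_insertOnes h0.le hx q d hd n, ← ENNReal.tsum_mul_left]
        refine ENNReal.tsum_le_tsum fun b => ?_
        rw [mul_left_comm, enorm_mul]
        exact mul_le_mul' le_rfl (hle q d b n)
      simp only [app, ← tsum_mul_left]
      rw [← Summable.tsum_comm (f := fun (b : Fin d → ℕ) (n : ℕ) => (x : ℂ) ^ (∑ i, b i) *
          (colKer x (1, l) m n *
          ((insertOnes q (List.ofFn b)).map (colKer x)).foldr app (fun _ => 1) n)) hs]
      refine tsum_congr fun n => ?_
      by_cases hn : colKer x (1, l) m n = 0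
      · simp [hn]
      · rw [← ih d hd n (hq n hn), ← tsum_mul_left]
        exact tsum_congr fun b => by ring
    · simp only [numNeOne, if_neg hw] at hd
      obtain _ | d := d
      · omega
      have hd : numNeOne q = d := by omega
      have hE := tsum_enorm_insertOnes h0.le hx ((w, l) :: q) (d + 1)
        (by simp [numNeOne, hw, hd]) m
      have hfinb : ∀ b : Fin (d + 1) → ℕ, ((insertOnes ((w, l) :: q) (List.ofFn b)).map
          (colKer x)).foldr appE (fun _ => 1) m ≠ ∞ := fun b htop => by
        refine hfin (top_unique ?_)
        rw [← hE]
        refine le_trans (le_of_eq ?_) (ENNReal.le_tsum b)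
        rw [htop]
        refine (ENNReal.mul_top ?_).symm
        simpa using pow_ne_zero (∑ i, b i) (show (x : ℂ) ≠ 0 by exact_mod_cast h0.ne')
      set G : (Fin d → ℕ) → ℕ → ℂ := fun c n => (x : ℂ) ^ (∑ i, c i) *
        ((insertOnes q (List.ofFn c)).map (colKer x)).foldr app (fun _ => 1) n with hG
      set A : ℕ → ℕ → ℂ := fun b₀ n => (x : ℂ) ^ b₀ * insKer x w b₀ m n with hA
      have hterm : ∀ (b₀ : ℕ) (c : Fin d → ℕ),
          (x : ℂ) ^ (∑ i, (Fin.cons b₀ c : Fin (d + 1) → ℕ) i) *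
          ((insertOnes ((w, l) :: q) (List.ofFn (Fin.cons b₀ c : Fin (d + 1) → ℕ))).map
            (colKer x)).foldr app (fun _ => 1) m
          = ∑' n : ℕ, A b₀ n * G c n * ((n : ℂ) ^ (l - 1))⁻¹ := fun b₀ c => by
        have := hfinb (Fin.cons b₀ c)
        rw [insertOnes_ne_one hw] at this ⊢
        rw [foldr_app_insert hx _ _ _ _ _ this, app, ← tsum_mul_left]
        refine tsum_congr fun n => ?_
        simp only [hA, hG, Fin.sum_univ_succ, Fin.cons_zero, Fin.cons_succ, pow_add]
        ring
      have hEA : ∀ n, ∑' b₀, ‖A b₀ n‖ₑ = ‖kerR x (.arr w) m n‖ₑ := fun n => by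
        rw [← tsum_enorm_insKer h0.le hx hw]
        simp only [hA, enorm_mul]
      have hEG : ∀ n, ∑' c, ‖G c n‖ₑ ≤ (q.map (colKerR x)).foldr appE (fun _ => 1) n :=
        fun n => by
          rw [← tsum_enorm_insertOnes h0.le hx q d hd n]
          exact ENNReal.tsum_le_tsum fun b => hle q d b n
      have hEAG : ∀ n : ℕ, ∑' t : ℕ × (Fin d → ℕ), ‖A t.1 n * G t.2 n * ((n : ℂ) ^ (l - 1))⁻¹‖ₑ
          ≤ ‖colKerR x (w, l) m n‖ₑ * (q.map (colKerR x)).foldr appE (fun _ => 1) n := fun n => by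
        rw [ENNReal.tsum_prod']
        simp only [enorm_mul, ENNReal.tsum_mul_left, ENNReal.tsum_mul_right]
        rw [hEA, colKerR, enorm_mul, mul_right_comm]
        exact mul_le_mul' le_rfl (hEG n)
      have hs : Summable fun p : (ℕ × (Fin d → ℕ)) × ℕ =>
          A p.1.1 p.2 * G p.1.2 p.2 * ((p.2 : ℂ) ^ (l - 1))⁻¹ := by
        refine summable_of_tsum_enorm_ne_top (ne_top_of_le_ne_top hfin ?_)
        rw [ENNReal.tsum_prod', ENNReal.tsum_comm]
        exact ENNReal.tsum_le_tsum hEAG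
      rw [← (Fin.consEquiv fun _ : Fin (d + 1) => ℕ).tsum_eq]
      simp only [consEquiv_apply', hterm]
      rw [← Summable.tsum_comm (f := fun (t : ℕ × (Fin d → ℕ)) (n : ℕ) =>
        A t.1 n * G t.2 n * ((n : ℂ) ^ (l - 1))⁻¹) hs]
      simp only [List.map_cons, List.foldr_cons, app]
      refine tsum_congr fun n => ?_
      by_cases hn : colKerR x (w, l) m n = 0
      -- Finiteness of the remaining columns is not available here, but the absolute bound forces
      -- every term to vanish.
      · have hz := hEAG n
        rw [hn, enorm_zero, zero_mul, nonpos_iff_eq_zero, ENNReal.tsum_eq_zero] at hz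
        simp only [enorm_eq_zero] at hz
        simp [hn, hz]
      · have hqn := hq n hn
        have h1 := hasSum_insKer hx hw m n
        have h2 := (hsum q d hd n hqn).hasSum
        rw [ih d hd n hqn] at h2
        have hAG : Summable fun t : ℕ × (Fin d → ℕ) => A t.1 n * G t.2 n := by
          refine summable_of_tsum_enorm_ne_top ?_
          rw [ENNReal.tsum_prod']
          simp only [enorm_mul, ENNReal.tsum_mul_left, ENNReal.tsum_mul_right]
          rw [hEA]
          exact ENNReal.mul_ne_top enorm_ne_top (ne_top_of_le_ne_top hqn (hEG n))
        rw [tsum_mul_right, (h1.mul h2 hAG).tsum_eq, colKerR]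
        ring

lemma pos_of_mem_insertOnes {q : IndexPair} (hq : ∀ c ∈ q, 0 < c.2) (bs : List ℕ) :
    ∀ c ∈ insertOnes q bs, 0 < c.2 := by
  induction q generalizing bs with
  | nil => simp [insertOnes]
  | cons col q ih =>
    obtain ⟨w, l⟩ := col
    have hl : 0 < l := hq (w, l) List.mem_cons_self
    have ih := ih fun c h => hq c (List.mem_cons_of_mem _ h)
    intro c hc
    unfold insertOnes at hc
    split_ifs at hc
    · rcases List.mem_cons.1 hc with rfl | hc
      · exact hl
      · exact ih _ c hc
    · rcases List.mem_append.1 hc with hc | hc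
      · rw [List.eq_of_mem_replicate hc]
        exact one_pos
      · rcases List.mem_cons.1 hc with rfl | hc
        · exact hl
        · exact ih _ c hc

/-- Pairs `((i, j), b)` with `b` of sum `i` are the same as pairs `(b, j)`. -/
def antidiagonalTupleProdEquiv (d : ℕ) :
    (Σ t : ℕ × ℕ, Nat.antidiagonalTuple d t.1) ≃ (Fin d → ℕ) × ℕ where
  toFun s := (s.2.1, s.1.2)
  invFun t := ⟨(∑ i, t.1 i, t.2), ⟨t.1, Nat.mem_antidiagonalTuple.2 rfl⟩⟩
  left_inv := by
    rintro ⟨⟨i, j⟩, ⟨b, hb⟩⟩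
    obtain rfl := Nat.mem_antidiagonalTuple.1 hb
    rfl
  right_inv _ := rfl

/-- The generating function of the sums `O_h` with insertions. -/
theorem hasSum_ohnoSum_insertOnes (h0 : 0 < x) (hx : x < 1) (q : IndexPair)
    (hq : ∀ c ∈ q, 0 < c.2) (d : ℕ) (hd : numNeOne q = d)
    (hfin : (q.map (colKerR x)).foldr appE (fun _ => 1) 0 ≠ ∞) :
    (∀ (b : Fin d → ℕ) (h : ℕ), OhnoConverges h (insertOnes q (List.ofFn b))) ∧
    HasSum (fun h => (x : ℂ) ^ h * ∑ i ∈ range (h + 1), ∑ b ∈ Nat.antidiagonalTuple d i,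
        ohnoSum (h - i) (insertOnes q (List.ofFn b)))
      ((q.map (colKerR x)).foldr app (fun _ => 1) 0) := by
  have hE := tsum_enorm_insertOnes h0.le hx q d hd 0
  have hfinb : ∀ b : Fin d → ℕ, ((insertOnes q (List.ofFn b)).map
      (colKer x)).foldr appE (fun _ => 1) 0 ≠ ∞ := fun b htop => by
    refine hfin (top_unique ?_)
    rw [← hE]
    refine le_trans (le_of_eq ?_) (ENNReal.le_tsum b)
    rw [htop]
    refine (ENNReal.mul_top ?_).symm
    simpa using pow_ne_zero (∑ i, b i) (show (x : ℂ) ≠ 0 by exact_mod_cast h0.ne')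
  have hO := fun b : Fin d → ℕ =>
    hasSum_ohnoSum h0 hx _ (pos_of_mem_insertOnes hq (List.ofFn b)) (hfinb b)
  refine ⟨fun b => (hO b).1, ?_⟩
  set V : (Fin d → ℕ) × ℕ → ℂ := fun t =>
    (x : ℂ) ^ (∑ i, t.1 i) * ((x : ℂ) ^ t.2 * ohnoSum t.2 (insertOnes q (List.ofFn t.1)))
  have hsV : Summable V := by
    refine summable_of_tsum_enorm_ne_top (ne_top_of_le_ne_top hfin ?_)
    rw [ENNReal.tsum_prod', ← hE]
    refine ENNReal.tsum_le_tsum fun b => ?_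
    simp only [V, enorm_mul _ (_ * _), ENNReal.tsum_mul_left]
    exact mul_le_mul' le_rfl (hO b).2.2
  have hV : HasSum V ((q.map (colKerR x)).foldr app (fun _ => 1) 0) := by
    refine hsV.hasSum_iff.2 ?_
    rw [hsV.tsum_prod, ← (hasSum_insertOnes h0 hx q d hd 0 hfin).tsum_eq]
    refine tsum_congr fun b => ?_
    simp only [V, tsum_mul_left]
    rw [(hO b).2.1.tsum_eq]
  have hW : HasSum (fun t : ℕ × ℕ => ∑ b ∈ Nat.antidiagonalTuple d t.1, V (b, t.2))
      ((q.map (colKerR x)).foldr app (fun _ => 1) 0) := by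
    refine ((antidiagonalTupleProdEquiv d).hasSum_iff.2 hV).sigma fun t => ?_
    rw [← sum_coe_sort]
    exact hasSum_fintype _
  -- The family is now indexed by `(i, j)`, with `i` the number of inserted columns and `j` the
  -- weight of the Ohno sum; grouping by `i + j = h` gives the coefficients.
  refine (Finset.HasAntidiagonal.sigmaAntidiagonalEquivProd.hasSum_iff.2 hW).sigma fun h => ?_
  have e : (x : ℂ) ^ h * ∑ i ∈ range (h + 1), ∑ b ∈ Nat.antidiagonalTuple d i,
        ohnoSum (h - i) (insertOnes q (List.ofFn b))
      = ∑ t ∈ antidiagonal h, ∑ b ∈ Nat.antidiagonalTuple d t.1, V (b, t.2) := by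
    rw [Nat.sum_antidiagonal_eq_sum_range_succ fun i j =>
      ∑ b ∈ Nat.antidiagonalTuple d i, V (b, j), mul_sum]
    refine sum_congr rfl fun i hi => ?_
    rw [mul_sum]
    refine sum_congr rfl fun b hb => ?_
    have hi' : i + (h - i) = h := Nat.add_sub_cancel' (by
      rw [mem_range] at hi
      omega)
    simp only [V]
    rw [Nat.mem_antidiagonalTuple.1 hb, ← mul_assoc, ← pow_add, hi']
  rw [e, ← sum_coe_sort]
  exact hasSum_fintype _

/-- Once the lower coefficients vanish, divide by `x ^ n` and let `x` tend to `0` from the right;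
the series at `ε / 2` dominates. -/
lemma eq_zero_of_hasSum_pow_mul_zero {c : ℕ → ℂ} {ε : ℝ} (hε : 0 < ε)
    (h : ∀ x : ℝ, 0 < x → x < ε → HasSum (fun n => (x : ℂ) ^ n * c n) 0) (n : ℕ) : c n = 0 := by
  induction n using Nat.strong_induction_on with
  | _ n ih =>
    have hs : ∀ x : ℝ, 0 < x → x < ε → HasSum (fun j => (x : ℂ) ^ j * c (j + n)) 0 := by
      intro x h0 hx
      have hx0 : (x : ℂ) ^ n ≠ 0 := pow_ne_zero _ (by exact_mod_cast h0.ne')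
      have h1 := (hasSum_nat_add_iff' n).2 (h x h0 hx)
      rw [sum_eq_zero fun i hi => by rw [ih i (mem_range.1 hi), mul_zero], sub_zero] at h1
      have h2 := h1.mul_left ((x : ℂ) ^ n)⁻¹
      rw [mul_zero] at h2
      refine h2.congr_fun fun j => ?_
      rw [pow_add]
      field_simp
    have h1 : Tendsto (fun x : ℝ => ∑' j, (x : ℂ) ^ j * c (j + n)) (𝓝[>] 0)
        (𝓝 (∑' j, (0 : ℂ) ^ j * c (j + n))) := by
      refine tendsto_tsum_of_dominated_convergence
        (hs (ε / 2) (by linarith) (by linarith)).summable.norm (fun j => ?_) ?_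
      · have : Continuous fun x : ℝ => (x : ℂ) ^ j * c (j + n) := by fun_prop
        have := (this.tendsto 0).mono_left (nhdsWithin_le_nhds (s := Set.Ioi 0))
        simpa using this
      · filter_upwards [Ioo_mem_nhdsGT (show (0 : ℝ) < ε / 2 by linarith)] with x hx j
        rw [norm_mul, norm_mul, norm_pow, norm_pow, Complex.norm_real, Complex.norm_real,
          Real.norm_of_nonneg hx.1.le, Real.norm_of_nonneg (by linarith)]
        exact mul_le_mul_of_nonneg_right (pow_le_pow_left₀ hx.1.le hx.2.le j) (norm_nonneg _)
    have h2 : Tendsto (fun x : ℝ => ∑' j, (x : ℂ) ^ j * c (j + n)) (𝓝[>] 0) (𝓝 0) := by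
      refine tendsto_const_nhds.congr' ?_
      filter_upwards [Ioo_mem_nhdsGT hε] with x hx
      exact (hs x hx.1 hx.2).tsum_eq.symm
    have h3 := tendsto_nhds_unique h1 h2
    rw [tsum_eq_single 0 fun j hj => by rw [zero_pow hj, zero_mul]] at h3
    simpa using h3

/-! ### The dual pair -/

open Classical in
/-- Being an arrow `→z` with `z ≠ 1`. -/
noncomputable def Letter.neOne : Letter → Bool
  | .up => false
  | .arr z => if z = 1 then false else true

lemma div_sub_one_ne_one {z : ℂ} (hz : z ≠ 1) : z / (z - 1) ≠ 1 := fun h => by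
  rw [div_eq_one_iff_eq (sub_ne_zero.2 hz)] at h
  exact one_ne_zero (α := ℂ) (by linear_combination h)

lemma Letter.neOne_dual (ℓ : Letter) : ℓ.dual.neOne = ℓ.neOne := by
  cases ℓ with
  | up => simp [Letter.dual, Letter.neOne]
  | arr z =>
    by_cases hz : z = 1
    · simp [Letter.dual, Letter.neOne, hz]
    · simp [Letter.dual, Letter.neOne, hz, div_sub_one_ne_one hz]

lemma word_cons (q : ℂ × ℕ) (p : IndexPair) :
    word (q :: p) = Letter.arr q.1 :: (List.replicate (q.2 - 1) Letter.up ++ word p) := by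
  simp [word]

lemma word_append (p q : IndexPair) : word (p ++ q) = word p ++ word q := by
  simp [word]

lemma numNeOne_eq_countP (p : IndexPair) : numNeOne p = (word p).countP Letter.neOne := by
  induction p with
  | nil => rfl
  | cons q p ih =>
    rw [word_cons, List.countP_cons, List.countP_append, numNeOne, ih]
    have : (List.replicate (q.2 - 1) Letter.up).countP Letter.neOne = 0 :=
      List.countP_eq_zero.2 fun ℓ h => by
        rw [List.eq_of_mem_replicate h]
        simp [Letter.neOne]
    by_cases hq : q.1 = 1 <;> simp [Letter.neOne, hq, this]

lemma prod_sign_eq (W : List Letter) :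
    (W.map Letter.sign).prod = (-1) ^ W.countP Letter.neOne := by
  induction W with
  | nil => simp
  | cons ℓ W ih =>
    rw [List.map_cons, List.prod_cons, ih, List.countP_cons]
    cases ℓ with
    | up => simp [Letter.sign, Letter.neOne]
    | arr z =>
      by_cases hz : z = 1
      · simp [Letter.sign, Letter.neOne, hz]
      · simp [Letter.sign, Letter.neOne, hz, pow_succ]

lemma countP_dualWord (W : List Letter) :
    (dualWord W).countP Letter.neOne = W.countP Letter.neOne := by
  rw [dualWord, List.countP_reverse, List.countP_map]
  congr 1
  ext ℓ
  simp [Letter.neOne_dual]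

lemma iota_eq_numNeOne (p : IndexPair) : iota p = numNeOne p := by
  induction p with
  | nil => rfl
  | cons q p ih =>
    have hle : (p.map Prod.fst).count 1 ≤ p.length := by
      simpa using (List.count_le_length (a := (1 : ℂ)) (l := p.map Prod.fst))
    unfold iota at ih ⊢
    rw [numNeOne, ← ih, List.map_cons, List.count_cons, List.length_cons]
    by_cases hq : q.1 = 1
    · simp [hq]
    · simp only [hq, beq_iff_eq, if_false, add_zero]
      omega

lemma iterate_arrow (j : ℕ) (v : ℂ) (q : IndexPair) :
    (fun s => arrow s v)^[j] q = q ++ List.replicate j (v, 1) := by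
  induction j with
  | zero => simp
  | succ j ih =>
    rw [Function.iterate_succ_apply', ih, arrow, List.append_assoc, List.replicate_succ']

lemma transportColumn_eq (z : ℂ) (k : ℕ) (q : IndexPair) :
    transportColumn (z, k) q = if z = 1 then up (q ++ List.replicate (k - 1) (1, 1))
      else q ++ List.replicate (k - 1) (1, 1) ++ [(z / (z - 1), 1)] := by
  simp only [transportColumn, iterate_arrow]
  rfl

lemma up_append_singleton (q : IndexPair) (c : ℂ × ℕ) :
    up (q ++ [c]) = q ++ [(c.1, c.2 + 1)] := List.modifyLast_concat _ _ _

/-- Nonemptiness matters because `up` leaves the empty pair unchanged and would lose the letter. -/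
lemma word_up {q : IndexPair} (hq : q ≠ []) (hpos : ∀ c ∈ q, 0 < c.2) :
    word (up q) = word q ++ [Letter.up] := by
  obtain ⟨q', c, rfl⟩ := (List.eq_nil_or_concat q).resolve_left hq
  rw [List.concat_eq_append] at hpos ⊢
  obtain ⟨z, k⟩ := c
  have hk : 0 < k := hpos (z, k) (by simp)
  obtain ⟨k, rfl⟩ := Nat.exists_eq_add_of_le' hk
  rw [up_append_singleton]
  simp [word, List.replicate_succ']

lemma pos_of_mem_up {q : IndexPair} (hpos : ∀ c ∈ q, 0 < c.2) : ∀ c ∈ up q, 0 < c.2 := by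
  rcases List.eq_nil_or_concat q with rfl | ⟨q', c, rfl⟩
  · simp [up, List.modifyLast, List.modifyLast.go]
  · rw [List.concat_eq_append] at hpos ⊢
    rw [up_append_singleton]
    intro c' hc'
    rcases List.mem_append.1 hc' with h | h
    · exact hpos c' (by simp [h])
    · rw [List.mem_singleton] at h
      subst h
      exact Nat.succ_pos _

lemma up_ne_nil {q : IndexPair} (hq : q ≠ []) : up q ≠ [] := by
  obtain ⟨q', c, rfl⟩ := (List.eq_nil_or_concat q).resolve_left hq
  rw [List.concat_eq_append, up_append_singleton]
  simp

/-- The exclusion of a final column `(1, 1)` prevents `↑` from being applied to the empty pair; for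
every other last column, at least one column exists before any `↑`. -/
lemma word_dual (p : IndexPair) (hp : ∀ q ∈ p, 0 < q.2) (hlast : ∀ q ∈ p.getLast?, q ≠ (1, 1)) :
    word (dual p) = dualWord (word p) ∧ (∀ q ∈ dual p, 0 < q.2) ∧ (p ≠ [] → dual p ≠ []) := by
  induction p with
  | nil => simp [dual, word, dualWord]
  | cons c p ih =>
    obtain ⟨z, k⟩ := c
    have hlast' : ∀ q ∈ p.getLast?, q ≠ (1, 1) := fun q hq => hlast q (by
      rw [List.getLast?_cons]
      simp only [Option.mem_def] at hq ⊢
      simp [hq])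
    obtain ⟨ih1, ih2, ih3⟩ := ih (fun q h => hp q (List.mem_cons_of_mem _ h)) hlast'
    have hk : 0 < k := hp (z, k) List.mem_cons_self
    set q := dual p ++ List.replicate (k - 1) ((1 : ℂ), 1) with hq
    have hd : dual ((z, k) :: p) = if z = 1 then up q else q ++ [(z / (z - 1), 1)] := by
      rw [← transportColumn_eq]
      rfl
    have hqpos : ∀ c ∈ q, 0 < c.2 := fun c hc => by
      rcases List.mem_append.1 hc with hc | hc
      · exact ih2 c hc
      · rw [List.eq_of_mem_replicate hc]
        exact one_pos
    have hqw : word q = dualWord (word p) ++ List.replicate (k - 1) (Letter.arr 1) := by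
      rw [hq, word_append, ih1]
      simp [word, List.flatMap_replicate]
    have hW : dualWord (word ((z, k) :: p)) = word q ++ [(Letter.arr z).dual] := by
      rw [word_cons, hqw]
      simp [dualWord, Letter.dual]
    rw [hd, hW]
    by_cases hz : z = 1
    · subst hz
      have hq0 : q ≠ [] := by
        by_cases hp0 : p = []
        · subst hp0
          have hk1 : k ≠ 1 := fun h => hlast (1, k) (by simp) (by rw [h])
          simp only [hq, ne_eq, List.append_eq_nil_iff, List.replicate_eq_nil_iff, not_and]
          omega
        · simp [hq, ih3 hp0]
      rw [if_pos rfl]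
      exact ⟨by rw [word_up hq0 hqpos]; simp [Letter.dual], pos_of_mem_up hqpos,
        fun _ => up_ne_nil hq0⟩
    · rw [if_neg hz]
      refine ⟨by rw [word_append]; simp [Letter.dual, hz, word], fun c hc => ?_, by simp⟩
      rcases List.mem_append.1 hc with hc | hc
      · exact hqpos c hc
      · rw [List.mem_singleton] at hc
        subst hc
        exact one_pos

/-- The counter of `blocks` corresponds to pending arrows `↑`: a leading entry `1` acts on the dual
of the rest as one more `↑`, and the next entry `l ≥ 2` creates the column that receives them. -/
lemma iterate_up_dual_ones (k : List ℕ) (hk : IsIndex k) (had : Admissible k) (a : ℕ)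
    (ha : k = [] → a = 0) :
    up^[a] (dual (ones k))
      = ones ((blocks a k).reverse.flatMap fun ab => List.replicate (ab.2 - 1) 1 ++ [ab.1 + 1]) := by
  induction k generalizing a with
  | nil =>
    rw [ha rfl]
    rfl
  | cons l k ih =>
    have hk' : IsIndex k := fun l' h => hk l' (List.mem_cons_of_mem _ h)
    have had' : Admissible k := fun l' h => had l' (by
      rw [List.getLast?_cons]
      simp only [Option.mem_def] at h ⊢
      simp [h])
    have hl : 0 < l := hk l List.mem_cons_self
    have hd : dual (ones (l :: k)) = up (dual (ones k) ++ List.replicate (l - 1) (1, 1)) := by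
      have := transportColumn_eq 1 l (dual (ones k))
      rw [if_pos rfl] at this
      exact this
    rw [hd]
    by_cases h1 : l = 1
    · subst h1
      have hk0 : k ≠ [] := fun h => by
        have := had 1 (by simp [h])
        omega
      have := ih hk' had' (a + 1) fun h => absurd h hk0
      rw [Function.iterate_succ_apply] at this
      simpa [blocks] using this
    · obtain ⟨l, rfl⟩ := Nat.exists_eq_add_of_le' (show 2 ≤ l by omega)
      have hu : ∀ a : ℕ, up^[a] (dual (ones k) ++ List.replicate l (1, 1) ++ [(1, 2)])
          = dual (ones k) ++ List.replicate l (1, 1) ++ [(1, a + 2)] := fun a => by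
        induction a with
        | zero => rfl
        | succ a iha =>
          rw [Function.iterate_succ_apply', iha, up_append_singleton]
      have h0 := ih hk' had' 0 fun _ => rfl
      rw [show l + 2 - 1 = l + 1 by omega, List.replicate_succ', ← List.append_assoc,
        up_append_singleton, hu]
      simp only [Function.iterate_zero, id_eq] at h0
      simp only [blocks, if_neg h1, List.reverse_cons, List.flatMap_append, ones,
        List.map_append, List.flatMap_cons, List.flatMap_nil, List.append_nil]
      simpa [List.map_replicate, ones] using h0

lemma dual_ones {k : List ℕ} (hk : IsIndex k) (had : Admissible k) :
    dual (ones k) = ones (dualIndex k) :=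
  iterate_up_dual_ones k hk had 0 fun _ => rfl

lemma insertOnes_ones (k bs : List ℕ) : insertOnes (ones k) bs = ones k := by
  induction k with
  | nil => rfl
  | cons l k ih =>
    rw [ones, List.map_cons, insertOnes_one]
    exact congrArg _ ih

lemma eq_ones_of_numNeOne_eq_zero {p : IndexPair} (h : numNeOne p = 0) :
    p = ones (p.map Prod.snd) := by
  induction p with
  | nil => rfl
  | cons q p ih =>
    obtain ⟨z, k⟩ := q
    by_cases hz : z = 1
    · subst hz
      simp only [numNeOne, if_true] at h
      simpa [ones] using ih h
    · simp [numNeOne, hz] at h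

/-! ### Letters of a pair with the dual condition -/

/-- The dual variable `z / (z - 1)` is the inverse of `1 - 1 / z`. -/
lemma valid_arr_of_mem_transportSet {z : ℂ} (h : z ∈ transportSet) : (Letter.arr z).Valid := by
  obtain ⟨h0, h1, h2⟩ := h
  by_cases hz : z = 1
  · exact Or.inl hz
  · refine Or.inr ⟨h1, ?_⟩
    have h3 : 1 ≤ ‖1 - 1 / z‖ := h2.resolve_left fun h => hz (by
      rw [div_eq_one_iff_eq h0] at h
      exact h.symm)
    have e : z / (z - 1) = (1 - 1 / z)⁻¹ := by
      rw [one_sub_div h0, inv_div]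
    rw [e, norm_inv]
    exact inv_le_one_of_one_le₀ h3

/-- Equality would mean `‖z‖ = ‖z - 1‖`, the perpendicular bisector of `0` and `1`. -/
lemma norm_div_sub_one_lt_one {z : ℂ} (hz : z ≠ 1) (h : ‖z / (z - 1)‖ ≤ 1) (hre : z.re ≠ 1 / 2) :
    ‖z / (z - 1)‖ < 1 := by
  refine lt_of_le_of_ne h fun he => hre ?_
  have h1 : ‖z - 1‖ ≠ 0 := norm_ne_zero_iff.2 (sub_ne_zero.2 hz)
  rw [norm_div, div_eq_one_iff_eq h1] at he
  have h2 : ‖z‖ ^ 2 = ‖z - 1‖ ^ 2 := by rw [he]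
  rw [← Complex.normSq_eq_norm_sq, ← Complex.normSq_eq_norm_sq, Complex.normSq_apply,
    Complex.normSq_apply] at h2
  simp only [Complex.sub_re, Complex.sub_im, Complex.one_re, Complex.one_im] at h2
  linarith

lemma exists_lastOK {ℓ : Letter} (h : ℓ.LastOK 0) : ∃ ε > 0, ∀ x < ε, ℓ.LastOK x := by
  cases ℓ with
  | up => exact ⟨1, one_pos, fun _ _ => trivial⟩
  | arr z =>
    have h : ‖z‖ < 1 - 0 := h
    refine ⟨1 - ‖z‖, by linarith, fun x hx => ?_⟩
    change ‖z‖ < 1 - x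
    linarith

lemma DualCondition.valid {p : IndexPair} (hp : DualCondition p) : ∀ ℓ ∈ word p, ℓ.Valid := by
  intro ℓ hℓ
  obtain ⟨q, hq, h⟩ := List.mem_flatMap.1 hℓ
  rcases List.mem_cons.1 h with rfl | h
  · exact valid_arr_of_mem_transportSet (hp.mem q hq)
  · rw [List.eq_of_mem_replicate h]
    trivial

lemma DualCondition.lastOK_head {p : IndexPair} (hp : DualCondition p) :
    ∀ ℓ ∈ (word p).head?, ℓ.dual.LastOK 0 := by
  cases p with
  | nil => simp [word]
  | cons q p =>
    intro ℓ hℓ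
    rw [word_cons, List.head?_cons, Option.mem_def, Option.some_inj] at hℓ
    subst hℓ
    by_cases hz : q.1 = 1
    · simp [Letter.dual, hz, Letter.LastOK]
    · simp only [Letter.dual, if_neg hz, Letter.LastOK, sub_zero]
      have hv := (valid_arr_of_mem_transportSet (hp.mem q List.mem_cons_self)).resolve_left hz
      exact norm_div_sub_one_lt_one hz hv.2 (hp.head q rfl)

lemma DualCondition.lastOK_getLast {p : IndexPair} (hp : DualCondition p) :
    ∀ ℓ ∈ (word p).getLast?, ℓ.LastOK 0 := by
  rcases List.eq_nil_or_concat p with rfl | ⟨p', q, rfl⟩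
  · simp [word]
  · rw [List.concat_eq_append] at hp ⊢
    intro ℓ hℓ
    obtain ⟨z, k⟩ := q
    have hw : word (p' ++ [(z, k)])
        = word p' ++ (Letter.arr z :: List.replicate (k - 1) Letter.up) := by
      simp [word]
    rw [hw, List.getLast?_append] at hℓ
    by_cases hk : 2 ≤ k
    · obtain ⟨k, rfl⟩ := Nat.exists_eq_add_of_le' hk
      rw [show k + 2 - 1 = k + 1 by omega, List.replicate_succ', ← List.cons_append] at hℓ
      simp only [List.getLast?_append, List.getLast?_singleton, Option.some_or, Option.mem_def,
        Option.some_inj] at hℓ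
      subst hℓ
      trivial
    · rw [show k - 1 = 0 by omega] at hℓ
      simp only [List.replicate_zero, List.getLast?_singleton, Option.some_or, Option.mem_def,
        Option.some_inj] at hℓ
      subst hℓ
      have h1 : ‖z‖ ≠ 1 := hp.last (fun h => hk (h k (by simp))) (z, k) (by simp)
      have h2 : ‖z‖ ≤ 1 := (hp.mem (z, k) (by simp)).2.1
      change ‖z‖ < 1 - 0
      rw [sub_zero]
      exact lt_of_le_of_ne h2 h1

lemma DualCondition.getLast_ne {p : IndexPair} (hp : DualCondition p) :
    ∀ q ∈ p.getLast?, q ≠ (1, 1) := by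
  rintro q hq rfl
  refine hp.last (fun h => ?_) _ hq (by simp)
  have := h 1 (by
    rw [List.getLast?_map, Option.mem_def.1 hq]
    rfl)
  omega

/-- Both generating functions agree. -/
theorem exists_forall_genFun_eq {p : IndexPair} (hp : DualCondition p) :
    ∃ ε > 0, ∀ x, 0 < x → x < ε → x < 1 ∧
      ((word p).map (kerL x)).foldr appE (fun _ => 1) 0 ≠ ∞ ∧
      ((dualWord (word p)).map (kerR x)).foldr appE (fun _ => 1) 0 ≠ ∞ ∧
      ((word p).map (kerL x)).foldr app (fun _ => 1) 0
        = (-1) ^ numNeOne p * ((dualWord (word p)).map (kerR x)).foldr app (fun _ => 1) 0 := by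
  -- The conditions at both ends are strict at `x = 0`, hence persist for small `x`.
  obtain ⟨ε₁, h₁, H₁⟩ : ∃ ε > 0, ∀ x < ε, ∀ ℓ ∈ (word p).head?, ℓ.dual.LastOK x := by
    rcases h : (word p).head? with _ | ℓ
    · exact ⟨1, one_pos, by simp⟩
    · simpa using exists_lastOK (hp.lastOK_head ℓ h)
  obtain ⟨ε₂, h₂, H₂⟩ : ∃ ε > 0, ∀ x < ε, ∀ ℓ ∈ (word p).getLast?, ℓ.LastOK x := by
    rcases h : (word p).getLast? with _ | ℓ
    · exact ⟨1, one_pos, by simp⟩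
    · simpa using exists_lastOK (hp.lastOK_getLast ℓ h)
  refine ⟨min 1 (min ε₁ ε₂), by positivity, fun x h0 hx => ?_⟩
  simp only [lt_min_iff] at hx
  obtain ⟨hx, hx1, hx2⟩ := hx
  have hv := hp.valid
  have hhead := H₁ x hx1
  have hlast := H₂ x hx2
  have hR : ∀ ℓ ∈ (dualWord (word p)).head?, ℓ.IsArr := fun v hv => by
    rw [dualWord, List.head?_reverse, List.getLast?_map] at hv
    simp only [Option.mem_def, Option.map_eq_some_iff] at hv
    obtain ⟨ℓ', hℓ', rfl⟩ := hv
    exact (hlast ℓ' hℓ').isArr_dual h0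
  have hR' : ∀ ℓ ∈ (dualWord (word p)).getLast?, ℓ.LastOK x := fun v hv => by
    rw [dualWord, List.getLast?_reverse, List.head?_map] at hv
    simp only [Option.mem_def, Option.map_eq_some_iff] at hv
    obtain ⟨ℓ', hℓ', rfl⟩ := hv
    exact hhead ℓ' hℓ'
  have hmono : ∀ (W : List Letter) (n : ℕ), (W.map (kerL x)).foldr appE (fun _ => 1) n
      ≤ (W.map (kerR x)).foldr appE (fun _ => 1) n := fun W => by
    induction W with
    | nil => exact fun n => le_rfl
    | cons ℓ W ih => exact fun n => appE_mono (enorm_kerL_le h0.le hx ℓ n) fun b _ => ih b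
  refine ⟨hx, ne_top_of_le_ne_top (foldr_appE_kerR_one_ne_top h0 hx (word p)
    (fun ℓ h => (hv ℓ h).normLe) (fun ℓ h => Letter.isArr_of_lastOK_dual h0 (hhead ℓ h)) hlast)
    (hmono _ _), foldr_appE_kerR_one_ne_top h0 hx _ (fun ℓ h => ?_) hR hR', ?_⟩
  · simp only [dualWord, List.mem_reverse, List.mem_map] at h
    obtain ⟨ℓ', hℓ', rfl⟩ := h
    exact (hv ℓ' hℓ').normLe_dual
  -- At `n = m = 0` both innermost connectors are identically `1`.
  · have h := foldr_app_kerL_conn h0 hx (word p) hv 0 0 (Or.inr hhead) (Or.inr hlast)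
    simp only [conn_zero_left hx, conn_zero_right hx, Complex.ofReal_one] at h
    rw [h, prod_sign_eq, numNeOne_eq_countP]

end MPL

/-! ### Comparison of coefficients -/

theorem mainTheorem7 (p : MPL.IndexPair) (hne : p ≠ [])
    (hpos : MPL.IsIndex (p.map Prod.snd)) (hp : MPL.DualCondition p) (h : ℕ) :
    MPL.OhnoConverges h p ∧
    (∀ i ∈ Finset.range (h + 1), ∀ b ∈ Finset.Nat.antidiagonalTuple (MPL.iota p) i,
      MPL.OhnoConverges (h - i) (MPL.insertOnes (MPL.dual p) (List.ofFn b))) ∧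
    MPL.ohnoSum h p =
      (-1) ^ MPL.iota p *
        ∑ i ∈ Finset.range (h + 1), ∑ b ∈ Finset.Nat.antidiagonalTuple (MPL.iota p) i,
          MPL.ohnoSum (h - i) (MPL.insertOnes (MPL.dual p) (List.ofFn b)) ∧
    (MPL.iota p = 0 →
      p = MPL.ones (p.map Prod.snd) ∧
      MPL.Admissible (p.map Prod.snd) ∧
      MPL.ohnoSum h (MPL.ones (p.map Prod.snd)) =
        MPL.ohnoSum h (MPL.ones (MPL.dualIndex (p.map Prod.snd)))) := by
  have hpos' : ∀ q ∈ p, 0 < q.2 := fun q hq => hpos q.2 (List.mem_map_of_mem hq)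
  obtain ⟨hw, hdpos, -⟩ := MPL.word_dual p hpos' hp.getLast_ne
  have hd : MPL.numNeOne (MPL.dual p) = MPL.iota p := by
    rw [MPL.iota_eq_numNeOne, MPL.numNeOne_eq_countP, MPL.numNeOne_eq_countP, hw,
      MPL.countP_dualWord]
  obtain ⟨ε, hε, H⟩ := MPL.exists_forall_genFun_eq hp
  have key : ∀ x : ℝ, 0 < x → x < ε → (∀ h, MPL.OhnoConverges h p) ∧
      (∀ (b : Fin (MPL.iota p) → ℕ) (h : ℕ),
        MPL.OhnoConverges h (MPL.insertOnes (MPL.dual p) (List.ofFn b))) ∧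
      HasSum (fun h => (x : ℂ) ^ h * (MPL.ohnoSum h p - (-1) ^ MPL.iota p *
        ∑ i ∈ Finset.range (h + 1), ∑ b ∈ Finset.Nat.antidiagonalTuple (MPL.iota p) i,
          MPL.ohnoSum (h - i) (MPL.insertOnes (MPL.dual p) (List.ofFn b)))) 0 := by
    intro x h0 hxε
    obtain ⟨hx, hL, hR, heq⟩ := H x h0 hxε
    rw [MPL.foldr_appE_word] at hL
    rw [← hw, MPL.foldr_appE_kerR_word] at hR
    rw [MPL.foldr_app_word, ← hw, MPL.foldr_app_kerR_word, ← MPL.iota_eq_numNeOne] at heq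
    obtain ⟨h1, h2, -⟩ := MPL.hasSum_ohnoSum h0 hx p hpos' hL
    obtain ⟨h3, h4⟩ := MPL.hasSum_ohnoSum_insertOnes h0 hx (MPL.dual p) hdpos _ hd hR
    refine ⟨h1, h3, ?_⟩
    have h5 := h2.sub (h4.mul_left ((-1) ^ MPL.iota p))
    rw [heq, sub_self] at h5
    exact h5.congr_fun fun j => by ring
  obtain ⟨hc1, hc2, -⟩ := key (ε / 2) (by linarith) (by linarith)
  have hmain := sub_eq_zero.1 (MPL.eq_zero_of_hasSum_pow_mul_zero hε
    (fun x h0 hx => (key x h0 hx).2.2) h)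
  refine ⟨hc1 h, fun i _ b _ => hc2 b _, hmain, fun hi => ?_⟩
  have h1 := MPL.eq_ones_of_numNeOne_eq_zero ((MPL.iota_eq_numNeOne p).symm.trans hi)
  -- A last column with index entry `1` would need a variable of norm different from `1`, whereas
  -- all variables are `1`.
  have hadm : MPL.Admissible (p.map Prod.snd) := by
    by_contra hna
    obtain ⟨q, hq⟩ := Option.ne_none_iff_exists'.1 (fun h => hne (List.getLast?_eq_none_iff.1 h))
    refine hp.last hna q hq ?_
    have hm := List.mem_of_getLast? hq
    rw [h1] at hm
    obtain ⟨l, -, rfl⟩ := List.mem_map.1 hm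
    simp
  refine ⟨h1, hadm, ?_⟩
  have h2 : MPL.dual p = MPL.ones (MPL.dualIndex (p.map Prod.snd)) := by
    conv_lhs => rw [h1]
    exact MPL.dual_ones hpos hadm
  rw [← h1, hmain, h2]
  simp only [MPL.insertOnes_ones]
  -- With no column to insert, the only tuple is the empty one, of sum `0`, so just the term `i = 0`
  -- survives.
  rw [hi, Finset.sum_range_succ']
  simp
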